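/- Let $p\in(0,1)$ and let $S$ be a countable set. Let $\beta_p=(1-p)\delta_0+p\delta_1$ be the Bernoulli measure on $\{0,1\}$, $\gamma$ the standard Gaussian measure on $\mathbb R$, and $\mu=\lambda_p^S\otimes\gamma^{\mathbb N}$ the product measure on $\{0,1\}^S\times\mathbb R^{\mathbb N}$, where $\lambda_p^S=\beta_p^{\otimes S}$ and $\gamma^{\mathbb N}=\gamma^{\otimes\mathbb N}$. Points are written $(x,y)$, and $\mathsf{Var}$, $\mathbb E$, $\|\cdot\|_1$ refer to $\mu$. For $f\in L^2(\mu)$, $s\in S$ and $i\in\mathbb N$ put $$\Delta_s f=f-\int f\,d\beta_p(x_s),\qquad \Delta_i f=f-\int f\,d\gamma(y_i),$$ the integration being over the single coordinate $x_s$, respectively $y_i$. Let $$c_{LS}(p)=\frac{\log p-\log(1-p)}{p-(1-p)}\quad (p\neq 1/2),\qquad c_{LS}(1/2)=2 .$$ The weighted Sobolev space $H_1^2(\mu)$ is the set of $f\in L^2(\mu)$ such that for every $i\in\mathbb N$ there is $h_i\in L^2(\mu)$ such that, for $\mu$-almost every $(x,y)$, with all coordinates other than $y_i$ fixed, the functions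 $y_i\mapsto f(x,y)$ and $y_i\mapsto h_i(x,y)$ are locally integrable and $$-\int_{\mathbb R} g'(y_i)f(x,y)\,dy_i=\int_{\mathbb R} g(y_i)h_i(x,y)\,dy_i$$ for every smooth compactly supported $g:\mathbb R\to\mathbb R$. The function $h_i$ is denoted $\frac{\partial f}{\partial y_i}$. Then for every $f\in H_1^2(\mu)$, $$\mathsf{Var}(f)\,\log\frac{\mathsf{Var}(f)}{\sum_{s\in S}\|\Delta_s f\|_1^2+\sum_{i\in\mathbb N}\|\Delta_i f\|_1^2}\;\le\; c_{LS}(p)\sum_{s\in S}\mathbb E\big((\Delta_s f)^2\big)+2\sum_{i\in\mathbb N}\mathbb E\Big(\Big(\frac{\partial f}{\partial y_i}\Big)^2\Big).$$ The inequality is understood in $[-\infty,\infty]$: the sums may be infinite, $\log 0=-\infty$, and the left-hand side is $0$ if $\mathsf{Var}(f)=0$. -/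

import Mathlib

open MeasureTheory ProbabilityTheory
open scoped ENNReal ContDiff unitInterval

noncomputable section

namespace BernoulliGauss

/-- The Bernoulli measure `(1 - p) δ₀ + p δ₁` on `{0, 1}`, with `false` for `0` and `true` for `1`. -/
def ber (p : I) : Measure Bool := bernoulliMeasure true false p

/-- The standard Gaussian measure on `ℝ`. -/
def gauss : Measure ℝ := gaussianReal 0 1

/-- The sample space `{0, 1}^S × ℝ^ℕ`. -/
abbrev Space (S : Type*) : Type _ := (S → Bool) × (ℕ → ℝ)

/-- The product measure `λ_p^S ⊗ γ^ℕ` on `{0, 1}^S × ℝ^ℕ`. -/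
def mu (S : Type*) (p : I) : Measure (Space S) :=
  (Measure.infinitePi (fun _ : S => ber p)).prod (Measure.infinitePi (fun _ : ℕ => gauss))

/-- The constant in the logarithmic Sobolev inequality of the Bernoulli measure; its value at
`p = 1/2` is the limit `2`. -/
def cLS (p : ℝ) : ℝ :=
  if p = 1 / 2 then 2 else (Real.log p - Real.log (1 - p)) / (p - (1 - p))

open Classical in
/-- `Δ_s f = f - ∫ f dβ_p`, the integral being over the Bernoulli coordinate `s`. -/
def deltaBer {S : Type*} (p : I) (s : S) (f : Space S → ℝ) (z : Space S) : ℝ :=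
  f z - ∫ b, f (Function.update z.1 s b, z.2) ∂(ber p)

/-- `Δ_i f = f - ∫ f dγ`, the integral being over the Gaussian coordinate `i`. -/
def deltaGauss {S : Type*} (i : ℕ) (f : Space S → ℝ) (z : Space S) : ℝ :=
  f z - ∫ t, f (z.1, Function.update z.2 i t) ∂gauss

/-- `f'` is a weak derivative of `f` on the real line. -/
def HasWeakDeriv (f f' : ℝ → ℝ) : Prop :=
  LocallyIntegrable f ∧ LocallyIntegrable f' ∧
    ∀ g : ℝ → ℝ, ContDiff ℝ ∞ g → HasCompactSupport g →
      ∫ t, g t * f' t = - ∫ t, deriv g t * f t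

/-- `h` is a square integrable partial derivative of `f` with respect to the Gaussian coordinate
`i`: on almost every line parallel to the `i`-th axis, `h` is a weak derivative of `f`. -/
def IsPartialDeriv {S : Type*} (p : I) (i : ℕ) (f h : Space S → ℝ) : Prop :=
  MemLp h 2 (mu S p) ∧
    ∀ᵐ z ∂(mu S p), HasWeakDeriv (fun t => f (z.1, Function.update z.2 i t))
      (fun t => h (z.1, Function.update z.2 i t))

/-- Membership in the weighted Sobolev space `H_1^2(λ_p^S ⊗ γ^ℕ)`. -/
def MemH12 {S : Type*} (p : I) (f : Space S → ℝ) : Prop :=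
  MemLp f 2 (mu S p) ∧ ∀ i : ℕ, ∃ h : Space S → ℝ, IsPartialDeriv p i f h

/-- `E(f ^ 2)`, with values in `[0, ∞]`. -/
def energy {S : Type*} (p : I) (f : Space S → ℝ) : ℝ≥0∞ :=
  ∫⁻ z, ENNReal.ofReal (f z ^ 2) ∂(mu S p)

end BernoulliGauss

end

noncomputable section

namespace BernoulliGauss

open Filter Topology

/-!
Enumerate the coordinates and integrate them out of `f` one after the other. The resulting
functions `f = f₀, f₁, f₂, …` converge in mean square to the mean of `f`, and the differences
`dₙ = fₙ - fₙ₊₁` are orthogonal, so that their second moments add up to `Var f`. The logarithmic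
Sobolev inequalities of the factors tensorize, so the entropy of `dₙ ^ 2` is at most the energy of
`dₙ`. As averages and gradients in different directions commute, this energy is the difference of
the energies of `fₙ` and `fₙ₊₁`. On the other hand, the entropy of `g ^ 2` is at least
`E(g ^ 2) (1 + log t) - t ‖g‖₁ ^ 2` for every `t > 0`, as one sees by testing its variational
formula with `log |g|`. Since `‖dₙ‖₁ ≤ ‖Δₙ f‖₁`, summation over `n` gives
`Var(f) (1 + log t) ≤ energy of f + t ∑ₙ ‖Δₙ f‖₁ ^ 2`, and the best `t` is
`Var(f) / ∑ₙ ‖Δₙ f‖₁ ^ 2`.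

For the two-point space the logarithmic Sobolev constant is the reciprocal of the logarithmic mean
of `p` and `1 - p`, and the inequality follows from the superadditivity of the logarithmic mean. For
the Gaussian measure it follows from the change of variables by the monotone transport of a density
to the Gaussian measure.
-/

/-! ### Markov operators and resampling kernels -/

section Kernels

variable {X : Type*} [MeasurableSpace X] {μ : Measure X} {κ η : Kernel X X}

theorem sq_integral_le_integral_sq [IsProbabilityMeasure μ] {f : X → ℝ} (hf : MemLp f 2 μ) :
    (∫ z, f z ∂μ) ^ 2 ≤ ∫ z, f z ^ 2 ∂μ := by
  have hvar : Var[f; μ] = ∫ z, f z ^ 2 ∂μ - (∫ z, f z ∂μ) ^ 2 := variance_eq_sub hf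
  linarith [variance_nonneg f μ]

/-- The Markov operator of the kernel `κ`: `avg κ f z` is the mean of `f` under `κ z`. -/
def avg (κ : Kernel X X) (f : X → ℝ) (z : X) : ℝ := ∫ w, f w ∂(κ z)

theorem stronglyMeasurable_avg [IsMarkovKernel κ] {f : X → ℝ} (hf : StronglyMeasurable f) :
    StronglyMeasurable (avg κ f) :=
  hf.integral_kernel

theorem avg_const_mul (κ : Kernel X X) (c : ℝ) (f : X → ℝ) :
    avg κ (fun z => c * f z) = fun z => c * avg κ f z :=
  funext fun _ => integral_const_mul c f

theorem avg_mem_Icc [IsMarkovKernel κ] {f : X → ℝ} (hf : StronglyMeasurable f) {a b : ℝ}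
    (hab : ∀ z, f z ∈ Set.Icc a b) (z : X) : avg κ f z ∈ Set.Icc a b := by
  have hint : Integrable f (κ z) := .of_mem_Icc a b hf.measurable.aemeasurable (ae_of_all _ hab)
  constructor
  · calc a = ∫ _, a ∂(κ z) := by simp
      _ ≤ avg κ f z := integral_mono (integrable_const _) hint fun w => (hab w).1
  · calc avg κ f z ≤ ∫ _, b ∂(κ z) := integral_mono hint (integrable_const _) fun w => (hab w).2
      _ = b := by simp

section Invariant

variable (hκ : κ.Invariant μ)
include hκ

theorem ae_ae_of_invariant {P : X → Prop} (hP : ∀ᵐ z ∂μ, P z) : ∀ᵐ z ∂μ, ∀ᵐ w ∂(κ z), P w :=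
  Measure.ae_ae_of_ae_comp (by rwa [hκ.def])

theorem avg_congr_ae {f g : X → ℝ} (hfg : f =ᵐ[μ] g) : avg κ f =ᵐ[μ] avg κ g := by
  filter_upwards [ae_ae_of_invariant hκ hfg] with z hz using integral_congr_ae hz

theorem ae_integrable_of_invariant {f : X → ℝ} (hf : Integrable f μ) :
    ∀ᵐ z ∂μ, Integrable f (κ z) :=
  Measure.ae_integrable_of_integrable_comp (by rwa [hκ.def])

theorem ae_memLp_two_of_invariant {f : X → ℝ} (hf : MemLp f 2 μ) :
    ∀ᵐ z ∂μ, MemLp f 2 (κ z) := by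
  filter_upwards [ae_ae_of_invariant hκ hf.1.ae_eq_mk,
    ae_integrable_of_invariant hκ hf.integrable_sq] with z hmk hsq
  exact (memLp_two_iff_integrable_sq ⟨_, hf.1.stronglyMeasurable_mk, hmk⟩).2 hsq

theorem integrable_comp_const_of_invariant {f : X → ℝ} (hf : Integrable f μ) :
    Integrable f ((κ ∘ₖ Kernel.const Unit μ) ()) := by
  rwa [← Measure.comp_eq_comp_const_apply, hκ.def]

theorem integrable_avg {f : X → ℝ} (hf : Integrable f μ) : Integrable (avg κ f) μ := by
  have hcomp := (integrable_comp_const_of_invariant hκ hf).integral_comp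
  rwa [Kernel.const_apply] at hcomp

theorem integral_avg {f : X → ℝ} (hf : Integrable f μ) : ∫ z, avg κ f z ∂μ = ∫ z, f z ∂μ := by
  have hcomp := Kernel.integral_comp (integrable_comp_const_of_invariant hκ hf)
  rw [← Measure.comp_eq_comp_const_apply, hκ.def, Kernel.const_apply] at hcomp
  exact hcomp.symm

theorem avg_add_ae {f g : X → ℝ} (hf : Integrable f μ) (hg : Integrable g μ) :
    avg κ (fun z => f z + g z) =ᵐ[μ] fun z => avg κ f z + avg κ g z := by
  filter_upwards [ae_integrable_of_invariant hκ hf, ae_integrable_of_invariant hκ hg]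
    with z hfz hgz using integral_add hfz hgz

theorem avg_sub_ae {f g : X → ℝ} (hf : Integrable f μ) (hg : Integrable g μ) :
    avg κ (fun z => f z - g z) =ᵐ[μ] fun z => avg κ f z - avg κ g z := by
  filter_upwards [ae_integrable_of_invariant hκ hf, ae_integrable_of_invariant hκ hg]
    with z hfz hgz using integral_sub hfz hgz

theorem integral_abs_avg_le {f : X → ℝ} (hf : Integrable f μ) :
    ∫ z, |avg κ f z| ∂μ ≤ ∫ z, |f z| ∂μ := by
  rw [← integral_avg hκ hf.abs]
  exact integral_mono (integrable_avg hκ hf).abs (integrable_avg hκ hf.abs)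
    fun z => abs_integral_le_integral_abs

variable [IsMarkovKernel κ]

theorem ae_sq_avg_le {f : X → ℝ} (hf : MemLp f 2 μ) :
    ∀ᵐ z ∂μ, avg κ f z ^ 2 ≤ avg κ (fun w => f w ^ 2) z := by
  filter_upwards [ae_memLp_two_of_invariant hκ hf] with z hz using sq_integral_le_integral_sq hz

variable [IsProbabilityMeasure μ]

theorem memLp_two_avg {f : X → ℝ} (hf : MemLp f 2 μ) : MemLp (avg κ f) 2 μ := by
  have hmeas := (integrable_avg hκ (hf.integrable one_le_two)).1
  rw [memLp_two_iff_integrable_sq hmeas]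
  refine (integrable_avg hκ hf.integrable_sq).mono' (hmeas.pow 2) ?_
  filter_upwards [ae_sq_avg_le hκ hf] with z hz
  rwa [Real.norm_eq_abs, abs_of_nonneg (sq_nonneg _)]

theorem variance_avg_le {f : X → ℝ} (hf : MemLp f 2 μ) : Var[avg κ f; μ] ≤ Var[f; μ] := by
  have hsq : ∫ z, avg κ f z ^ 2 ∂μ ≤ ∫ z, f z ^ 2 ∂μ :=
    calc ∫ z, avg κ f z ^ 2 ∂μ ≤ ∫ z, avg κ (fun w => f w ^ 2) z ∂μ :=
          integral_mono_ae (memLp_two_avg hκ hf).integrable_sq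
            (integrable_avg hκ hf.integrable_sq) (ae_sq_avg_le hκ hf)
      _ = ∫ z, f z ^ 2 ∂μ := integral_avg hκ hf.integrable_sq
  rw [variance_eq_sub hf, variance_eq_sub (memLp_two_avg hκ hf),
    integral_avg hκ (hf.integrable one_le_two)]
  exact sub_le_sub_right hsq _

end Invariant

theorem avg_comm_ae (hκ : κ.Invariant μ) (hη : η.Invariant μ) (hcomm : κ ∘ₖ η = η ∘ₖ κ)
    {f : X → ℝ} (hf : Integrable f μ) : avg κ (avg η f) =ᵐ[μ] avg η (avg κ f) := by
  filter_upwards [ae_integrable_of_invariant (hκ.comp hη) hf] with z hz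
  calc avg κ (avg η f) z = ∫ w, f w ∂(η ∘ₖ κ) z := (Kernel.integral_comp (hcomm ▸ hz)).symm
    _ = ∫ w, f w ∂(κ ∘ₖ η) z := by rw [hcomm]
    _ = avg η (avg κ f) z := Kernel.integral_comp hz

/-- A `μ`-invariant kernel whose Markov operator is a conditional expectation: almost surely with
respect to `κ z`, averages do not distinguish the resampled point from `z`. -/
structure IsResampling (κ : Kernel X X) (μ : Measure X) : Prop where
  invariant : κ.Invariant μ
  ae_avg_eq : ∀ f, StronglyMeasurable f → ∀ z, ∀ᵐ w ∂(κ z), avg κ f w = avg κ f z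

namespace IsResampling

variable (hκ : IsResampling κ μ)
include hκ

theorem avg_mul_comp_avg {g : X → ℝ} (hg : StronglyMeasurable g) (f : X → ℝ) (φ : ℝ → ℝ)
    (z : X) : avg κ (fun w => f w * φ (avg κ g w)) z = avg κ f z * φ (avg κ g z) := by
  have hconst : avg κ (fun w => f w * φ (avg κ g w)) z = ∫ w, f w * φ (avg κ g z) ∂(κ z) :=
    integral_congr_ae <| by filter_upwards [hκ.ae_avg_eq g hg z] with w hw; rw [hw]
  rw [hconst, integral_mul_const]; rfl

variable [IsMarkovKernel κ]

theorem avg_avg {f : X → ℝ} (hf : StronglyMeasurable f) (z : X) :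
    avg κ (avg κ f) z = avg κ f z := by
  rw [avg, integral_congr_ae (hκ.ae_avg_eq f hf z)]
  simp

variable [IsProbabilityMeasure μ]

theorem integral_mul_avg_self {f : X → ℝ} (hf : MemLp f 2 μ) :
    ∫ z, f z * avg κ f z ∂μ = ∫ z, avg κ f z ^ 2 ∂μ := by
  obtain ⟨f', hf', hff'⟩ := hf.1
  have havg := avg_congr_ae hκ.invariant hff'
  have hint : Integrable (fun z => f z * avg κ f' z) μ :=
    (hf.integrable_mul (memLp_two_avg hκ.invariant hf)).congr
      (by filter_upwards [havg] with z hz; rw [Pi.mul_apply, hz])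
  calc ∫ z, f z * avg κ f z ∂μ = ∫ z, f z * avg κ f' z ∂μ :=
        integral_congr_ae (by filter_upwards [havg] with z hz; rw [hz])
    _ = ∫ z, avg κ f z * avg κ f' z ∂μ := by
        rw [← integral_avg hκ.invariant hint]
        exact integral_congr_ae (ae_of_all _ (hκ.avg_mul_comp_avg hf' f id))
    _ = ∫ z, avg κ f z ^ 2 ∂μ :=
        integral_congr_ae (by filter_upwards [havg] with z hz; rw [hz, sq])

theorem integral_sq_sub_avg {f : X → ℝ} (hf : MemLp f 2 μ) :
    ∫ z, (f z - avg κ f z) ^ 2 ∂μ = ∫ z, f z ^ 2 ∂μ - ∫ z, avg κ f z ^ 2 ∂μ := by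
  have havg := memLp_two_avg hκ.invariant hf
  have hmul : Integrable (fun z => f z * avg κ f z) μ := hf.integrable_mul havg
  have hsub : Integrable (fun z => f z ^ 2 - 2 * (f z * avg κ f z)) μ :=
    hf.integrable_sq.sub (hmul.const_mul 2)
  calc ∫ z, (f z - avg κ f z) ^ 2 ∂μ
      = ∫ z, (f z ^ 2 - 2 * (f z * avg κ f z) + avg κ f z ^ 2) ∂μ := by congr with z; ring
    _ = ∫ z, f z ^ 2 ∂μ - 2 * ∫ z, f z * avg κ f z ∂μ + ∫ z, avg κ f z ^ 2 ∂μ := by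
        rw [integral_add hsub havg.integrable_sq,
          integral_sub hf.integrable_sq (hmul.const_mul 2), integral_const_mul]
    _ = ∫ z, f z ^ 2 ∂μ - ∫ z, avg κ f z ^ 2 ∂μ := by
        rw [hκ.integral_mul_avg_self hf]; ring

theorem integral_sq_sub_avg_eq_variance_sub {f : X → ℝ} (hf : MemLp f 2 μ) :
    ∫ z, (f z - avg κ f z) ^ 2 ∂μ = Var[f; μ] - Var[avg κ f; μ] := by
  rw [hκ.integral_sq_sub_avg hf, variance_eq_sub hf,
    variance_eq_sub (memLp_two_avg hκ.invariant hf),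
    integral_avg hκ.invariant (hf.integrable one_le_two)]
  simp only [Pi.pow_apply, sub_sub_sub_cancel_right]

end IsResampling

end Kernels

section IteratedAverages

variable {X : Type*} [MeasurableSpace X] {μ : Measure X} {K : ℕ → Kernel X X}

/-- The iterated average of `f` over the kernels `K 0, …, K (n - 1)`. -/
def avgIter (K : ℕ → Kernel X X) : ℕ → (X → ℝ) → X → ℝ
  | 0, f => f
  | n + 1, f => avg (K n) (avgIter K n f)

theorem avgIter_const_mul (c : ℝ) (f : X → ℝ) (n : ℕ) :
    avgIter K n (fun z => c * f z) = fun z => c * avgIter K n f z := by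
  induction n with
  | zero => rfl
  | succ n ih => simp only [avgIter, ih, avg_const_mul]

section Markov

variable [∀ n, IsMarkovKernel (K n)]

theorem stronglyMeasurable_avgIter {f : X → ℝ} (hf : StronglyMeasurable f) (n : ℕ) :
    StronglyMeasurable (avgIter K n f) := by
  induction n with
  | zero => exact hf
  | succ n ih => exact stronglyMeasurable_avg ih

theorem avgIter_mem_Icc {f : X → ℝ} (hf : StronglyMeasurable f) {a b : ℝ}
    (hab : ∀ z, f z ∈ Set.Icc a b) (n : ℕ) (z : X) : avgIter K n f z ∈ Set.Icc a b := by
  induction n generalizing z with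
  | zero => exact hab z
  | succ n ih => exact avg_mem_Icc (stronglyMeasurable_avgIter hf n) ih z

end Markov

section Invariant

variable (hK : ∀ n, (K n).Invariant μ)
include hK

theorem integrable_avgIter {f : X → ℝ} (hf : Integrable f μ) (n : ℕ) :
    Integrable (avgIter K n f) μ := by
  induction n with
  | zero => exact hf
  | succ n ih => exact integrable_avg (hK n) ih

theorem integral_avgIter {f : X → ℝ} (hf : Integrable f μ) (n : ℕ) :
    ∫ z, avgIter K n f z ∂μ = ∫ z, f z ∂μ := by
  induction n with
  | zero => rfl
  | succ n ih => exact (integral_avg (hK n) (integrable_avgIter hK hf n)).trans ih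

theorem integral_abs_avgIter_le {f : X → ℝ} (hf : Integrable f μ) (n : ℕ) :
    ∫ z, |avgIter K n f z| ∂μ ≤ ∫ z, |f z| ∂μ := by
  induction n with
  | zero => rfl
  | succ n ih => exact (integral_abs_avg_le (hK n) (integrable_avgIter hK hf n)).trans ih

theorem avgIter_add_ae {f g : X → ℝ} (hf : Integrable f μ) (hg : Integrable g μ) (n : ℕ) :
    avgIter K n (fun z => f z + g z) =ᵐ[μ] fun z => avgIter K n f z + avgIter K n g z := by
  induction n with
  | zero => rfl
  | succ n ih =>
    exact (avg_congr_ae (hK n) ih).trans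
      (avg_add_ae (hK n) (integrable_avgIter hK hf n) (integrable_avgIter hK hg n))

theorem avgIter_sub_ae {f g : X → ℝ} (hf : Integrable f μ) (hg : Integrable g μ) (n : ℕ) :
    avgIter K n (fun z => f z - g z) =ᵐ[μ] fun z => avgIter K n f z - avgIter K n g z := by
  have hadd := avgIter_add_ae hK hf (hg.const_mul (-1)) n
  simp only [avgIter_const_mul] at hadd
  simpa only [neg_one_mul, ← sub_eq_add_neg] using hadd

theorem avgIter_avg_ae {κ : Kernel X X} (hκ : κ.Invariant μ) (hcomm : ∀ n, K n ∘ₖ κ = κ ∘ₖ K n)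
    {f : X → ℝ} (hf : Integrable f μ) (n : ℕ) :
    avgIter K n (avg κ f) =ᵐ[μ] avg κ (avgIter K n f) := by
  induction n with
  | zero => rfl
  | succ n ih =>
    exact (avg_congr_ae (hK n) ih).trans
      (avg_comm_ae (hK n) hκ (hcomm n) (integrable_avgIter hK hf n))

variable [∀ n, IsMarkovKernel (K n)] [IsProbabilityMeasure μ]

theorem memLp_two_avgIter {f : X → ℝ} (hf : MemLp f 2 μ) (n : ℕ) :
    MemLp (avgIter K n f) 2 μ := by
  induction n with
  | zero => exact hf
  | succ n ih => exact memLp_two_avg (hK n) ih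

theorem variance_avgIter_le {f : X → ℝ} (hf : MemLp f 2 μ) (n : ℕ) :
    Var[avgIter K n f; μ] ≤ Var[f; μ] := by
  induction n with
  | zero => rfl
  | succ n ih => exact (variance_avg_le (hK n) (memLp_two_avgIter hK hf n)).trans ih

end Invariant

/-- The iterated averages of `u` converge in mean square to the mean of `u`. They all have this
same mean, so the convergence is expressed through their variances. -/
def MeanConv (K : ℕ → Kernel X X) (μ : Measure X) (u : X → ℝ) : Prop :=
  Tendsto (fun n => Var[avgIter K n u; μ]) atTop (𝓝 0)

theorem MeanConv.tendstoInMeasure [∀ n, IsMarkovKernel (K n)] [IsProbabilityMeasure μ]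
    (hK : ∀ n, (K n).Invariant μ) {u : X → ℝ} (hu : MemLp u 2 μ) (h : MeanConv K μ u) :
    TendstoInMeasure μ (fun n => avgIter K n u) atTop (fun _ => ∫ z, u z ∂μ) := by
  rw [tendstoInMeasure_iff_dist]
  intro ε hε
  have hbound : Tendsto (fun n => ENNReal.ofReal (Var[avgIter K n u; μ] / ε ^ 2)) atTop (𝓝 0) := by
    simpa using ENNReal.tendsto_ofReal (h.div_const (ε ^ 2))
  refine tendsto_of_tendsto_of_tendsto_of_le_of_le tendsto_const_nhds hbound
    (fun _ => zero_le) fun n => ?_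
  have hcheb := meas_ge_le_variance_div_sq (memLp_two_avgIter hK hu n) hε
  rwa [integral_avgIter hK (hu.integrable one_le_two) n] at hcheb

/-- A commuting family of resampling kernels whose iterated averages converge to the mean. -/
structure IsResamplingFamily (K : ℕ → Kernel X X) (μ : Measure X) : Prop where
  isResampling : ∀ n, IsResampling (K n) μ
  comm : ∀ m n, K m ∘ₖ K n = K n ∘ₖ K m
  meanConv : ∀ u : X → ℝ, MemLp u 2 μ → MeanConv K μ u

theorem IsResamplingFamily.invariant (hK : IsResamplingFamily K μ) (n : ℕ) :
    (K n).Invariant μ :=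
  (hK.isResampling n).invariant

end IteratedAverages

/-! ### Entropy bounds and their tensorization -/

section EntropyBounds

variable {X : Type*} [MeasurableSpace X] {μ : Measure X}

theorem abs_log_le_max_abs_log {a b x : ℝ} (ha : 0 < a) (hx : x ∈ Set.Icc a b) :
    |Real.log x| ≤ max |Real.log a| |Real.log b| :=
  abs_le_max_abs_abs (Real.log_le_log ha hx.1) (Real.log_le_log (ha.trans_le hx.1) hx.2)

theorem integrable_sq_mul_log {g u : X → ℝ} (hg : MemLp g 2 μ) (hu : Measurable u) {a b : ℝ}
    (ha : 0 < a) (hab : ∀ z, u z ∈ Set.Icc a b) :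
    Integrable (fun z => g z ^ 2 * Real.log (u z)) μ :=
  hg.integrable_sq.mul_bdd (c := max |Real.log a| |Real.log b|) hu.log.aestronglyMeasurable
    (ae_of_all _ fun z => abs_log_le_max_abs_log ha (hab z))

/-- The entropy of `g ^ 2` under `μ` is at most `E`. The entropy is expressed through its dual
variational formula, so that no integrability of `g ^ 2 * log (g ^ 2)` is presupposed. -/
def EntBound (μ : Measure X) (g : X → ℝ) (E : ℝ) : Prop :=
  ∀ ψ : X → ℝ, Measurable ψ → (∃ C, ∀ z, |ψ z| ≤ C) →
    ∫ z, g z ^ 2 * ψ z ∂μ ≤ (∫ z, g z ^ 2 ∂μ) * Real.log (∫ z, Real.exp (ψ z) ∂μ) + E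

namespace EntBound

variable {g : X → ℝ} {E : ℝ}

theorem nonneg [IsProbabilityMeasure μ] (h : EntBound μ g E) : 0 ≤ E := by
  simpa using h (fun _ => 0) measurable_const ⟨0, by simp⟩

theorem congr_ae (h : EntBound μ g E) {g' : X → ℝ} (hg : g =ᵐ[μ] g') : EntBound μ g' E := by
  intro ψ hψ hbdd
  have hsq : ∫ z, g' z ^ 2 ∂μ = ∫ z, g z ^ 2 ∂μ :=
    integral_congr_ae (by filter_upwards [hg] with z hz; rw [hz])
  have hmul : ∫ z, g' z ^ 2 * ψ z ∂μ = ∫ z, g z ^ 2 * ψ z ∂μ :=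
    integral_congr_ae (by filter_upwards [hg] with z hz; rw [hz])
  rw [hsq, hmul]
  exact h ψ hψ hbdd

theorem map {Ω : Type*} [MeasurableSpace Ω] {ν : Measure Ω} {U : Ω → X} (hU : Measurable U)
    (hg : Measurable g) (h : EntBound ν (fun s => g (U s)) E) : EntBound (ν.map U) g E := by
  rintro ψ hψ ⟨C, hC⟩
  have hpull := h (fun s => ψ (U s)) (hψ.comp hU) ⟨C, fun s => hC _⟩
  have hmul : Measurable fun z => g z ^ 2 * ψ z := (hg.pow_const 2).mul hψ
  rwa [integral_map hU.aemeasurable hmul.aestronglyMeasurable,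
    integral_map hU.aemeasurable (hg.pow_const 2).aestronglyMeasurable,
    integral_map hU.aemeasurable hψ.exp.aestronglyMeasurable]

theorem integral_sq_mul_log_le (h : EntBound μ g E) {u : X → ℝ} (hu : Measurable u) {a b : ℝ}
    (ha : 0 < a) (hab : ∀ z, u z ∈ Set.Icc a b) :
    ∫ z, g z ^ 2 * Real.log (u z) ∂μ ≤ (∫ z, g z ^ 2 ∂μ) * Real.log (∫ z, u z ∂μ) + E := by
  have hdual := h (fun z => Real.log (u z)) hu.log ⟨_, fun z => abs_log_le_max_abs_log ha (hab z)⟩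
  simpa only [Real.exp_log (ha.trans_le (hab _).1)] using hdual

end EntBound

theorem integral_sq_mul_log_le_avg {κ : Kernel X X} [IsMarkovKernel κ] (hκ : IsResampling κ μ)
    {g : X → ℝ} (hg : MemLp g 2 μ) {E : X → ℝ} (hE : Integrable E μ)
    (h : ∀ᵐ z ∂μ, EntBound (κ z) g (E z)) {u : X → ℝ} (hu : StronglyMeasurable u) {a b : ℝ}
    (ha : 0 < a) (hab : ∀ z, u z ∈ Set.Icc a b) :
    ∫ z, g z ^ 2 * Real.log (u z) ∂μ
      ≤ ∫ z, g z ^ 2 * Real.log (avg κ u z) ∂μ + ∫ z, E z ∂μ := by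
  have hint := integrable_sq_mul_log hg hu.measurable ha hab
  have hintAvg := integrable_sq_mul_log hg (stronglyMeasurable_avg hu).measurable ha
    (avg_mem_Icc (κ := κ) hu hab)
  have hle : ∀ᵐ z ∂μ, avg κ (fun w => g w ^ 2 * Real.log (u w)) z
      ≤ avg κ (fun w => g w ^ 2 * Real.log (avg κ u w)) z + E z := by
    filter_upwards [h] with z hz
    rw [hκ.avg_mul_comp_avg hu]
    exact hz.integral_sq_mul_log_le hu.measurable ha hab
  calc ∫ z, g z ^ 2 * Real.log (u z) ∂μ
      = ∫ z, avg κ (fun w => g w ^ 2 * Real.log (u w)) z ∂μ :=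
        (integral_avg hκ.invariant hint).symm
    _ ≤ ∫ z, (avg κ (fun w => g w ^ 2 * Real.log (avg κ u w)) z + E z) ∂μ :=
        integral_mono_ae (integrable_avg hκ.invariant hint)
          ((integrable_avg hκ.invariant hintAvg).add hE) hle
    _ = ∫ z, g z ^ 2 * Real.log (avg κ u z) ∂μ + ∫ z, E z ∂μ := by
        rw [integral_add (integrable_avg hκ.invariant hintAvg) hE,
          integral_avg hκ.invariant hintAvg]

variable {K : ℕ → Kernel X X} [∀ n, IsMarkovKernel (K n)]

theorem integral_sq_mul_log_le_avgIter (hK : ∀ n, IsResampling (K n) μ) {g : X → ℝ}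
    (hg : MemLp g 2 μ) {E : ℕ → X → ℝ} (hE : ∀ n, Integrable (E n) μ)
    (h : ∀ n, ∀ᵐ z ∂μ, EntBound (K n z) g (E n z)) {u : X → ℝ} (hu : StronglyMeasurable u)
    {a b : ℝ} (ha : 0 < a) (hab : ∀ z, u z ∈ Set.Icc a b) (n : ℕ) :
    ∫ z, g z ^ 2 * Real.log (u z) ∂μ
      ≤ ∫ z, g z ^ 2 * Real.log (avgIter K n u z) ∂μ + ∑ j ∈ Finset.range n, ∫ z, E j z ∂μ := by
  induction n with
  | zero => simp [avgIter]
  | succ n ih =>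
    have hstep := integral_sq_mul_log_le_avg (hK n) hg (hE n) (h n)
      (stronglyMeasurable_avgIter (K := K) hu n) ha (avgIter_mem_Icc hu hab n)
    rw [Finset.sum_range_succ]
    simp only [avgIter]
    linarith

variable [IsProbabilityMeasure μ]

theorem exists_tendsto_integral_sq_mul_log_avgIter (hK : IsResamplingFamily K μ) {g : X → ℝ}
    (hg : MemLp g 2 μ) {u : X → ℝ} (hu : StronglyMeasurable u) {a b : ℝ} (ha : 0 < a)
    (hab : ∀ z, u z ∈ Set.Icc a b) :
    ∃ ns : ℕ → ℕ, Tendsto (fun k => ∫ z, g z ^ 2 * Real.log (avgIter K (ns k) u z) ∂μ) atTop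
      (𝓝 ((∫ z, g z ^ 2 ∂μ) * Real.log (∫ z, u z ∂μ))) := by
  have hu2 : MemLp u 2 μ := memLp_of_bounded (ae_of_all _ hab) hu.aestronglyMeasurable 2
  have hmean : 0 < ∫ z, u z ∂μ := by
    have hle : ∫ _, a ∂μ ≤ ∫ z, u z ∂μ :=
      integral_mono (integrable_const a) (hu2.integrable one_le_two) fun z => (hab z).1
    exact ha.trans_le (by simpa using hle)
  obtain ⟨ns, -, hns⟩ :=
    ((hK.meanConv u hu2).tendstoInMeasure hK.invariant hu2).exists_seq_tendsto_ae
  refine ⟨ns, ?_⟩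
  rw [← integral_mul_const]
  refine tendsto_integral_of_dominated_convergence
    (fun z => g z ^ 2 * max |Real.log a| |Real.log b|)
    (fun k => (integrable_sq_mul_log hg (stronglyMeasurable_avgIter hu _).measurable ha
      (avgIter_mem_Icc hu hab _)).1)
    (hg.integrable_sq.mul_const _) (fun k => ae_of_all _ fun z => ?_) ?_
  · rw [norm_mul, Real.norm_eq_abs, Real.norm_eq_abs, abs_of_nonneg (sq_nonneg _)]
    exact mul_le_mul_of_nonneg_left
      (abs_log_le_max_abs_log ha (avgIter_mem_Icc hu hab _ z)) (sq_nonneg _)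
  · filter_upwards [hns] with z hz using (hz.log hmean.ne').const_mul _

theorem entBound_tsum (hK : IsResamplingFamily K μ) {g : X → ℝ} (hg : MemLp g 2 μ)
    {E : ℕ → X → ℝ} (hE : ∀ n, Integrable (E n) μ)
    (h : ∀ n, ∀ᵐ z ∂μ, EntBound (K n z) g (E n z)) (hs : Summable fun n => ∫ z, E n z ∂μ) :
    EntBound μ g (∑' n, ∫ z, E n z ∂μ) := by
  rintro ψ hψ ⟨C, hC⟩
  have hu : StronglyMeasurable fun z => Real.exp (ψ z) := hψ.exp.stronglyMeasurable
  have hab : ∀ z, Real.exp (ψ z) ∈ Set.Icc (Real.exp (-C)) (Real.exp C) := fun z =>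
    ⟨Real.exp_le_exp.2 (abs_le.1 (hC z)).1, Real.exp_le_exp.2 (abs_le.1 (hC z)).2⟩
  have hE0 : ∀ n, 0 ≤ ∫ z, E n z ∂μ := fun n =>
    integral_nonneg_of_ae (by filter_upwards [h n] with z hz using hz.nonneg)
  obtain ⟨ns, hns⟩ :=
    exists_tendsto_integral_sq_mul_log_avgIter hK hg hu (Real.exp_pos _) hab
  refine ge_of_tendsto' (hns.add_const _) fun k => ?_
  have hstep := integral_sq_mul_log_le_avgIter hK.isResampling hg hE h hu
    (Real.exp_pos _) hab (ns k)
  simp only [Real.log_exp] at hstep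
  exact hstep.trans (add_le_add_right (hs.sum_le_tsum _ fun j _ => hE0 j) _)

end EntropyBounds

/-! ### From entropy bounds to bounds of the second moment by the first -/

section SecondMoment

theorem sq_mul_one_add_log_sub_le {x s v : ℝ} (hs : 0 < s)
    (hv : min |x| (s * Real.exp 1) ≤ v) :
    x ^ 2 * (1 + Real.log s) - s * |x| ≤ x ^ 2 * Real.log v := by
  rcases eq_or_ne x 0 with rfl | hx
  · simp
  have hx : 0 < |x| := abs_pos.2 hx
  have hsx : 0 < s / |x| := div_pos hs hx
  have hlog : 1 + Real.log s - s / |x| ≤ Real.log v := by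
    rcases min_le_iff.1 hv with hv | hv
    · have htangent := Real.log_le_sub_one_of_pos hsx
      rw [Real.log_div hs.ne' hx.ne'] at htangent
      linarith [Real.log_le_log hx hv]
    · have hmono := Real.log_le_log (by positivity) hv
      rw [Real.log_mul hs.ne' (Real.exp_pos 1).ne', Real.log_exp] at hmono
      linarith
  calc x ^ 2 * (1 + Real.log s) - s * |x| = x ^ 2 * (1 + Real.log s - s / |x|) := by
        rw [← sq_abs]; field_simp
    _ ≤ x ^ 2 * Real.log v := mul_le_mul_of_nonneg_left hlog (sq_nonneg x)

variable {X : Type*} [MeasurableSpace X] {μ : Measure X} [IsProbabilityMeasure μ] {g : X → ℝ}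
  {E : ℝ}

namespace EntBound

theorem integral_sq_mul_one_add_log_le (h : EntBound μ g E) (hg : Measurable g)
    (hg2 : MemLp g 2 μ) {s ε : ℝ} (hs : 0 < s) (hε : 0 < ε) :
    (∫ z, g z ^ 2 ∂μ) * (1 + Real.log s) - s * ∫ z, |g z| ∂μ
      ≤ (∫ z, g z ^ 2 ∂μ) * Real.log (∫ z, |g z| ∂μ + ε) + E := by
  -- The dual formula is tested with `log v` for a truncation `v` of `|g|`.
  set v : X → ℝ := fun z => max ε (min |g z| (s * Real.exp 1))
  have hvm : Measurable v := measurable_const.max (hg.abs.min measurable_const)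
  have hvI : ∀ z, v z ∈ Set.Icc ε (max ε (s * Real.exp 1)) := fun z =>
    ⟨le_max_left _ _, max_le_max le_rfl (min_le_right _ _)⟩
  have hvint : Integrable v μ := .of_mem_Icc _ _ hvm.aemeasurable (ae_of_all _ hvI)
  have habs : Integrable (fun z => |g z|) μ := (hg2.integrable one_le_two).abs
  have hv0 : 0 < ∫ z, v z ∂μ := by
    have hle : ∫ _, ε ∂μ ≤ ∫ z, v z ∂μ :=
      integral_mono (integrable_const ε) hvint fun z => (hvI z).1
    exact hε.trans_le (by simpa using hle)
  have hvle : ∫ z, v z ∂μ ≤ ∫ z, |g z| ∂μ + ε := by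
    calc ∫ z, v z ∂μ ≤ ∫ z, (|g z| + ε) ∂μ :=
          integral_mono hvint (habs.add (integrable_const ε)) fun z =>
            max_le (le_add_of_nonneg_left (abs_nonneg _))
              ((min_le_left _ _).trans (le_add_of_nonneg_right hε.le))
      _ = ∫ z, |g z| ∂μ + ε := by simp [integral_add habs (integrable_const ε)]
  calc (∫ z, g z ^ 2 ∂μ) * (1 + Real.log s) - s * ∫ z, |g z| ∂μ
      = ∫ z, (g z ^ 2 * (1 + Real.log s) - s * |g z|) ∂μ := by
        rw [integral_sub (hg2.integrable_sq.mul_const _) (habs.const_mul s), integral_mul_const,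
          integral_const_mul]
    _ ≤ ∫ z, g z ^ 2 * Real.log (v z) ∂μ :=
        integral_mono ((hg2.integrable_sq.mul_const _).sub (habs.const_mul s))
          (integrable_sq_mul_log hg2 hvm hε hvI)
          fun z => sq_mul_one_add_log_sub_le hs (le_max_right _ _)
    _ ≤ (∫ z, g z ^ 2 ∂μ) * Real.log (∫ z, v z ∂μ) + E :=
        h.integral_sq_mul_log_le hvm hε hvI
    _ ≤ (∫ z, g z ^ 2 ∂μ) * Real.log (∫ z, |g z| ∂μ + ε) + E := by
        gcongr

theorem integral_sq_mul_le (h : EntBound μ g E) (hg : MemLp g 2 μ) {t : ℝ} (ht : 0 < t) :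
    (∫ z, g z ^ 2 ∂μ) * (1 + Real.log t) ≤ E + t * (∫ z, |g z| ∂μ) ^ 2 := by
  wlog hgm : Measurable g generalizing g
  · obtain ⟨g', hg', hgg'⟩ := hg.1
    have hsq : ∫ z, g z ^ 2 ∂μ = ∫ z, g' z ^ 2 ∂μ :=
      integral_congr_ae (by filter_upwards [hgg'] with z hz; rw [hz])
    have habs : ∫ z, |g z| ∂μ = ∫ z, |g' z| ∂μ :=
      integral_congr_ae (by filter_upwards [hgg'] with z hz; rw [hz])
    rw [hsq, habs]
    exact this (h.congr_ae hgg') ((memLp_congr_ae hgg').1 hg) hg'.measurable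
  set A := ∫ z, |g z| ∂μ
  have happrox : ∀ ε > 0, (∫ z, g z ^ 2 ∂μ) * (1 + Real.log t) ≤ E + t * (A + ε) * A := by
    intro ε hε
    have hAε : 0 < A + ε := add_pos_of_nonneg_of_pos (integral_nonneg fun z => abs_nonneg _) hε
    have hbound := h.integral_sq_mul_one_add_log_le hgm hg (mul_pos ht hAε) hε
    rw [Real.log_mul ht.ne' hAε.ne'] at hbound
    linarith
  have hlim : Tendsto (fun ε : ℝ => E + t * (A + ε) * A) (𝓝[>] 0) (𝓝 (E + t * (A + 0) * A)) :=
    tendsto_nhdsWithin_of_tendsto_nhds (Continuous.tendsto (by fun_prop) 0)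
  calc (∫ z, g z ^ 2 ∂μ) * (1 + Real.log t) ≤ E + t * (A + 0) * A :=
        ge_of_tendsto hlim (eventually_mem_nhdsWithin.mono happrox)
    _ = E + t * A ^ 2 := by ring

end EntBound

end SecondMoment

/-! ### The Falik–Samorodnitsky argument -/

section FalikSamorodnitsky

variable {X : Type*} [MeasurableSpace X] {μ : Measure X} {K : ℕ → Kernel X X} {c : ℕ → ℝ}
  {Γ : ℕ → (X → ℝ) → (X → ℝ) → Prop}

/-- `Γ n g G` is a notion of "`G` is the `n`-th partial gradient of `g`" for which the kernel
`K n` satisfies a logarithmic Sobolev inequality with constant `c n`. -/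
structure IsLogSobolev (K : ℕ → Kernel X X) (μ : Measure X) (c : ℕ → ℝ)
    (Γ : ℕ → (X → ℝ) → (X → ℝ) → Prop) : Prop where
  memLp : ∀ {n g G}, Γ n g G → MemLp g 2 μ
  memLp_grad : ∀ {n g G}, Γ n g G → MemLp G 2 μ
  sub : ∀ {n g g' G G'}, Γ n g G → Γ n g' G' → Γ n (fun z => g z - g' z) (fun z => G z - G' z)
  avg_of_ne : ∀ {m n g G}, m ≠ n → Γ n g G → Γ n (avg (K m) g) (avg (K m) G)
  avg_self : ∀ {n g G}, Γ n g G → Γ n (avg (K n) g) (fun _ => 0)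
  entBound : ∀ {n g G}, Γ n g G → ∀ᵐ z ∂μ, EntBound (K n z) g (c n * avg (K n) (fun w => G w ^ 2) z)

/-- The partial gradient in direction `j` of the iterated average over `K 0, …, K (n - 1)` of a
function whose partial gradient in this direction is `G`. -/
def gradIter (K : ℕ → Kernel X X) (j : ℕ) (G : X → ℝ) : ℕ → X → ℝ
  | 0 => G
  | n + 1 => if n = j then fun _ => 0 else avg (K n) (gradIter K j G n)

/-- The share of direction `j` in the energy of the `n`-th iterated average of a function with
partial gradients `G`. -/
def energyIter (K : ℕ → Kernel X X) (μ : Measure X) (c : ℕ → ℝ) (G : ℕ → X → ℝ) (n j : ℕ) : ℝ :=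
  c j * ∫ z, gradIter K j (G j) n z ^ 2 ∂μ

theorem integral_abs_avgIter_sub_succ_le (hK : ∀ n, (K n).Invariant μ)
    (hcomm : ∀ m n, K m ∘ₖ K n = K n ∘ₖ K m) {f : X → ℝ} (hf : Integrable f μ) (n : ℕ) :
    ∫ z, |avgIter K n f z - avgIter K (n + 1) f z| ∂μ ≤ ∫ z, |f z - avg (K n) f z| ∂μ := by
  have hcommute : (fun z => avgIter K n f z - avgIter K (n + 1) f z)
      =ᵐ[μ] avgIter K n (fun z => f z - avg (K n) f z) := by
    filter_upwards [avgIter_sub_ae hK hf (integrable_avg (hK n) hf) n,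
      avgIter_avg_ae hK (hK n) (fun m => hcomm m n) hf n] with z hsub havg
    rw [hsub, havg, avgIter]
  calc ∫ z, |avgIter K n f z - avgIter K (n + 1) f z| ∂μ
      = ∫ z, |avgIter K n (fun z => f z - avg (K n) f z) z| ∂μ :=
        integral_congr_ae (by filter_upwards [hcommute] with z hz; rw [hz])
    _ ≤ ∫ z, |f z - avg (K n) f z| ∂μ :=
        integral_abs_avgIter_le hK (hf.sub (integrable_avg (hK n) hf)) n

namespace IsLogSobolev

variable (hΓ : IsLogSobolev K μ c Γ) {f : X → ℝ} {G : ℕ → X → ℝ} (hG : ∀ n, Γ n f (G n))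
include hΓ hG

theorem grad_avgIter (n j : ℕ) : Γ j (avgIter K n f) (gradIter K j (G j) n) := by
  induction n with
  | zero => exact hG j
  | succ n ih =>
    unfold gradIter
    split_ifs with h
    · subst h
      exact hΓ.avg_self ih
    · exact hΓ.avg_of_ne h ih

theorem grad_avgIter_sub (n j : ℕ) : Γ j (fun z => avgIter K n f z - avgIter K (n + 1) f z)
    (fun z => gradIter K j (G j) n z - gradIter K j (G j) (n + 1) z) :=
  hΓ.sub (hΓ.grad_avgIter hG n j) (hΓ.grad_avgIter hG (n + 1) j)

variable [∀ n, IsMarkovKernel (K n)]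

theorem energy_nonneg (hK : ∀ n, (K n).Invariant μ) (n : ℕ) : 0 ≤ c n * ∫ z, G n z ^ 2 ∂μ := by
  rw [← integral_avg (hK n) (hΓ.memLp_grad (hG n)).integrable_sq, ← integral_const_mul]
  exact integral_nonneg_of_ae (by filter_upwards [hΓ.entBound (hG n)] with z hz using hz.nonneg)

theorem energyIter_nonneg (hK : ∀ n, (K n).Invariant μ) (n j : ℕ) :
    0 ≤ energyIter K μ c G n j :=
  hΓ.energy_nonneg (hΓ.grad_avgIter hG n) hK j

variable [IsProbabilityMeasure μ]

protected theorem entBound_tsum (hK : IsResamplingFamily K μ)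
    (hs : Summable fun n => c n * ∫ z, G n z ^ 2 ∂μ) :
    EntBound μ f (∑' n, c n * ∫ z, G n z ^ 2 ∂μ) := by
  have hsq : ∀ n, Integrable (fun z => G n z ^ 2) μ := fun n =>
    (hΓ.memLp_grad (hG n)).integrable_sq
  have henergy : ∀ n, ∫ z, c n * avg (K n) (fun w => G n w ^ 2) z ∂μ
      = c n * ∫ z, G n z ^ 2 ∂μ := fun n => by
    rw [integral_const_mul, integral_avg (hK.invariant n) (hsq n)]
  simp only [← henergy] at hs ⊢
  exact entBound_tsum hK (hΓ.memLp (hG 0))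
    (fun n => (integrable_avg (hK.invariant n) (hsq n)).const_mul (c n))
    (fun n => hΓ.entBound (hG n)) hs

theorem energyIter_sub_succ (hK : ∀ n, IsResampling (K n) μ) (n j : ℕ) :
    c j * ∫ z, (gradIter K j (G j) n z - gradIter K j (G j) (n + 1) z) ^ 2 ∂μ
      = energyIter K μ c G n j - energyIter K μ c G (n + 1) j := by
  rw [energyIter, energyIter, ← mul_sub]
  by_cases h : n = j
  · simp [gradIter, h]
  · simp only [gradIter, h, if_false]
    rw [(hK n).integral_sq_sub_avg (hΓ.memLp_grad (hΓ.grad_avgIter hG n j))]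

theorem energyIter_succ_le (hK : ∀ n, IsResampling (K n) μ) (n j : ℕ) :
    energyIter K μ c G (n + 1) j ≤ energyIter K μ c G n j := by
  rw [← sub_nonneg, ← hΓ.energyIter_sub_succ hG hK n j]
  exact hΓ.energy_nonneg (hΓ.grad_avgIter_sub hG n) (fun n => (hK n).invariant) j

theorem summable_energyIter (hK : ∀ n, IsResampling (K n) μ)
    (hs : Summable fun n => c n * ∫ z, G n z ^ 2 ∂μ) (n : ℕ) :
    Summable (energyIter K μ c G n) := by
  induction n with
  | zero => exact hs
  | succ n ih =>
    exact ih.of_nonneg_of_le (hΓ.energyIter_nonneg hG (fun n => (hK n).invariant) (n + 1))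
      (hΓ.energyIter_succ_le hG hK n)

theorem variance_sub_succ_mul_le (hK : IsResamplingFamily K μ)
    (hs : Summable fun n => c n * ∫ z, G n z ^ 2 ∂μ) {t : ℝ} (ht : 0 < t) (n : ℕ) :
    (Var[avgIter K n f; μ] - Var[avgIter K (n + 1) f; μ]) * (1 + Real.log t)
      ≤ ∑' j, energyIter K μ c G n j - ∑' j, energyIter K μ c G (n + 1) j
        + t * (∫ z, |f z - avg (K n) f z| ∂μ) ^ 2 := by
  have hf := hΓ.memLp (hG 0)
  have hd := hΓ.grad_avgIter_sub hG n
  have hsum := hΓ.summable_energyIter hG hK.isResampling hs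
  have henergy := hΓ.energyIter_sub_succ hG hK.isResampling n
  have hent : EntBound μ (fun z => avgIter K n f z - avgIter K (n + 1) f z)
      (∑' j, energyIter K μ c G n j - ∑' j, energyIter K μ c G (n + 1) j) := by
    have htsum := hΓ.entBound_tsum hd hK
      (by simpa only [henergy] using (hsum n).sub (hsum (n + 1)))
    simpa only [henergy, (hsum n).tsum_sub (hsum (n + 1))] using htsum
  have hvar : ∫ z, (avgIter K n f z - avgIter K (n + 1) f z) ^ 2 ∂μ
      = Var[avgIter K n f; μ] - Var[avgIter K (n + 1) f; μ] :=
    (hK.isResampling n).integral_sq_sub_avg_eq_variance_sub (memLp_two_avgIter hK.invariant hf n)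
  rw [← hvar]
  have habs := integral_abs_avgIter_sub_succ_le hK.invariant hK.comm (hf.integrable one_le_two) n
  have : 0 ≤ ∫ z, |avgIter K n f z - avgIter K (n + 1) f z| ∂μ :=
    integral_nonneg fun z => abs_nonneg _
  refine (hent.integral_sq_mul_le (hΓ.memLp (hd 0)) ht).trans ?_
  gcongr

theorem variance_mul_le (hK : IsResamplingFamily K μ)
    (hs : Summable fun n => c n * ∫ z, G n z ^ 2 ∂μ)
    (hd : Summable fun n => (∫ z, |f z - avg (K n) f z| ∂μ) ^ 2) {t : ℝ} (ht : 0 < t) :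
    Var[f; μ] * (1 + Real.log t)
      ≤ ∑' n, c n * ∫ z, G n z ^ 2 ∂μ + t * ∑' n, (∫ z, |f z - avg (K n) f z| ∂μ) ^ 2 := by
  have htele : ∀ N, (Var[f; μ] - Var[avgIter K N f; μ]) * (1 + Real.log t)
      ≤ ∑' j, energyIter K μ c G 0 j - ∑' j, energyIter K μ c G N j
        + t * ∑ n ∈ Finset.range N, (∫ z, |f z - avg (K n) f z| ∂μ) ^ 2 := fun N => by
    have hsum := Finset.sum_le_sum (s := Finset.range N)
      fun n _ => hΓ.variance_sub_succ_mul_le hG hK hs ht n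
    rwa [← Finset.sum_mul, Finset.sum_add_distrib, ← Finset.mul_sum, Finset.sum_range_sub',
      Finset.sum_range_sub'] at hsum
  have hle : ∀ N, (Var[f; μ] - Var[avgIter K N f; μ]) * (1 + Real.log t)
      ≤ ∑' n, c n * ∫ z, G n z ^ 2 ∂μ + t * ∑' n, (∫ z, |f z - avg (K n) f z| ∂μ) ^ 2 :=
    fun N => (htele N).trans <| add_le_add
      (sub_le_self _ (tsum_nonneg (hΓ.energyIter_nonneg hG hK.invariant N)))
      (mul_le_mul_of_nonneg_left (hd.sum_le_tsum _ fun _ _ => sq_nonneg _) ht.le)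
  have hlim : Tendsto (fun N => (Var[f; μ] - Var[avgIter K N f; μ]) * (1 + Real.log t)) atTop
      (𝓝 ((Var[f; μ] - 0) * (1 + Real.log t))) :=
    ((hK.meanConv f (hΓ.memLp (hG 0))).const_sub _).mul_const _
  rw [sub_zero] at hlim
  exact le_of_tendsto' hlim hle

end IsLogSobolev

end FalikSamorodnitsky

/-! ### The logarithmic Sobolev inequality of the Bernoulli measure -/

section TwoPoint

/-- The logarithmic mean of `x` and `y`. For distinct positive numbers it equals
`(x - y) / (log x - log y)`; the integral representation also covers `x = y`. -/
def logMean (x y : ℝ) : ℝ := ∫ θ in (0 : ℝ)..1, x ^ θ * y ^ (1 - θ)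

theorem continuous_rpow_mul_rpow_one_sub {x y : ℝ} (hx : 0 < x) (hy : 0 < y) :
    Continuous fun θ : ℝ => x ^ θ * y ^ (1 - θ) :=
  (Real.continuous_const_rpow hx.ne').mul
    ((Real.continuous_const_rpow hy.ne').comp (continuous_const.sub continuous_id))

theorem logMean_comm (x y : ℝ) : logMean x y = logMean y x := by
  have hsubst := intervalIntegral.integral_comp_sub_left (a := 0) (b := 1)
    (fun θ : ℝ => x ^ θ * y ^ (1 - θ)) 1
  simp only [sub_zero, sub_self, sub_sub_cancel] at hsubst
  rw [logMean, ← hsubst, logMean]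
  simp only [mul_comm]

theorem logMean_self {x : ℝ} (hx : 0 < x) : logMean x x = x := by
  simp [logMean, ← Real.rpow_add hx]

theorem logMean_pos {x y : ℝ} (hx : 0 < x) (hy : 0 < y) : 0 < logMean x y :=
  intervalIntegral.intervalIntegral_pos_of_pos
    ((continuous_rpow_mul_rpow_one_sub hx hy).intervalIntegrable _ _)
    (fun _ => by positivity) one_pos

theorem logMean_mul_log_sub_log {x y : ℝ} (hx : 0 < x) (hy : 0 < y) :
    logMean x y * (Real.log x - Real.log y) = x - y := by
  have hderiv : ∀ θ ∈ Set.uIcc (0 : ℝ) 1, HasDerivAt (fun θ : ℝ => x ^ θ * y ^ (1 - θ))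
      (x ^ θ * y ^ (1 - θ) * (Real.log x - Real.log y)) θ := fun θ _ => by
    convert! ((hasDerivAt_id θ).const_rpow hx).mul
      (((hasDerivAt_id θ).const_sub 1).const_rpow hy) using 1
    simp only [id]
    ring
  have hftc := intervalIntegral.integral_eq_sub_of_hasDerivAt hderiv
    (((continuous_rpow_mul_rpow_one_sub hx hy).mul continuous_const).intervalIntegrable _ _)
  rw [intervalIntegral.integral_mul_const] at hftc
  simpa [logMean] using hftc

theorem logMean_mul_mul {x y : ℝ} (hx : 0 < x) (hy : 0 < y) {c : ℝ} (hc : 0 < c) :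
    logMean (x * c) (y * c) = c * logMean x y := by
  rw [logMean, logMean, ← intervalIntegral.integral_const_mul]
  congr 1 with θ
  have hcθ : c ^ θ * c ^ (1 - θ) = c := by simp [← Real.rpow_add hc]
  rw [Real.mul_rpow hx.le hc.le, Real.mul_rpow hy.le hc.le]
  linear_combination x ^ θ * y ^ (1 - θ) * hcθ

theorem rpow_mul_rpow_one_sub_le {x y X Y θ : ℝ} (hx : 0 < x) (hy : 0 < y) (hX : 0 < X)
    (hY : 0 < Y) (hθ : θ ∈ Set.Icc 0 1) :
    x ^ θ * y ^ (1 - θ) ≤ X ^ θ * Y ^ (1 - θ) * (θ * (x / X) + (1 - θ) * (y / Y)) := by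
  have hamgm := Real.geom_mean_le_arith_mean2_weighted hθ.1 (sub_nonneg.2 hθ.2)
    (div_pos hx hX).le (div_pos hy hY).le (by ring)
  rw [Real.div_rpow hx.le hX.le, Real.div_rpow hy.le hY.le, div_mul_div_comm,
    div_le_iff₀ (by positivity)] at hamgm
  linarith

theorem logMean_add_logMean_le {x₁ y₁ x₂ y₂ : ℝ} (hx₁ : 0 < x₁) (hy₁ : 0 < y₁) (hx₂ : 0 < x₂)
    (hy₂ : 0 < y₂) : logMean x₁ y₁ + logMean x₂ y₂ ≤ logMean (x₁ + x₂) (y₁ + y₂) := by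
  have hX := add_pos hx₁ hx₂
  have hY := add_pos hy₁ hy₂
  have hint : ∀ {x y : ℝ}, 0 < x → 0 < y →
      IntervalIntegrable (fun θ : ℝ => x ^ θ * y ^ (1 - θ)) volume 0 1 := fun hx hy =>
    (continuous_rpow_mul_rpow_one_sub hx hy).intervalIntegrable _ _
  rw [logMean, logMean, ← intervalIntegral.integral_add (hint hx₁ hy₁) (hint hx₂ hy₂)]
  refine intervalIntegral.integral_mono_on zero_le_one ((hint hx₁ hy₁).add (hint hx₂ hy₂))
    (hint hX hY) fun θ hθ => ?_
  have hone : θ * (x₁ / (x₁ + x₂)) + (1 - θ) * (y₁ / (y₁ + y₂))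
      + (θ * (x₂ / (x₁ + x₂)) + (1 - θ) * (y₂ / (y₁ + y₂))) = 1 := by
    field_simp
    ring
  refine (add_le_add (rpow_mul_rpow_one_sub_le hx₁ hy₁ hX hY hθ)
    (rpow_mul_rpow_one_sub_le hx₂ hy₂ hX hY hθ)).trans_eq ?_
  rw [← mul_add, hone, mul_one]

theorem cLS_mul_logMean {p : ℝ} (hp : 0 < p) (hp1 : p < 1) : cLS p * logMean p (1 - p) = 1 := by
  rw [cLS]
  split_ifs with h
  · subst h
    norm_num [logMean_self]
  · have hlog := logMean_mul_log_sub_log hp (sub_pos.2 hp1)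
    have hne : p - (1 - p) ≠ 0 := fun h0 => h (by linarith)
    rw [div_mul_eq_mul_div, mul_comm, hlog, div_self hne]

theorem cLS_pos {p : ℝ} (hp : 0 < p) (hp1 : p < 1) : 0 < cLS p :=
  pos_of_mul_pos_left (by rw [cLS_mul_logMean hp hp1]; exact one_pos)
    (logMean_pos hp (sub_pos.2 hp1)).le

theorem quadratic_form_nonneg {α β γ : ℝ} (hα : 0 < α) (h : β ^ 2 ≤ α * γ) (a b : ℝ) :
    0 ≤ α * a ^ 2 - 2 * β * (a * b) + γ * b ^ 2 := by
  refine nonneg_of_mul_nonneg_right ?_ hα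
  calc 0 ≤ (α * a - β * b) ^ 2 + (α * γ - β ^ 2) * b ^ 2 :=
        add_nonneg (sq_nonneg _) (mul_nonneg (sub_nonneg.2 h) (sq_nonneg b))
    _ = α * (α * a ^ 2 - 2 * β * (a * b) + γ * b ^ 2) := by ring

section

variable {p q c r s : ℝ} (hp : 0 < p) (hq : 0 < q) (hpq : p + q = 1) (hc : c * logMean p q = 1)
  (hs : 0 < s) (hrs : q * r + p * s = 1)
include hp hq hpq hc hs hrs

theorem mul_weighted_log_le_log_mul_log (hr : 1 < r) :
    c * (p * Real.log s + q * Real.log r) ≤ Real.log r * Real.log s := by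
  have hr1 : r - 1 = p * (r - s) := by linear_combination hrs - r * hpq
  have hs1 : 1 - s = q * (r - s) := by linear_combination s * hpq - hrs
  have hd : 0 < r - s := pos_of_mul_pos_right (hr1 ▸ sub_pos.2 hr) hp.le
  have hs' : s < 1 := sub_pos.1 (hs1 ▸ mul_pos hq hd)
  have hA : 0 < Real.log r := Real.log_pos hr
  have hB : Real.log s < 0 := Real.log_neg hs hs'
  have hc0 : 0 < c := pos_of_mul_pos_left (hc ▸ one_pos) (logMean_pos hp hq).le
  have hLr : logMean r 1 * Real.log r = p * (r - s) := by
    simpa [hr1] using logMean_mul_log_sub_log (one_pos.trans hr) one_pos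
  have hLs : logMean 1 s * -Real.log s = q * (r - s) := by
    simpa [hs1] using logMean_mul_log_sub_log one_pos hs
  have hsuper : logMean 1 s + (r - s) * logMean p q ≤ logMean r 1 := by
    have h := logMean_add_logMean_le one_pos hs (sub_pos.2 hr) (sub_pos.2 hs')
    rwa [hr1, hs1, logMean_mul_mul hp hq hd, ← hr1, ← hs1, add_sub_cancel, add_sub_cancel] at h
  refine le_of_mul_le_mul_left ?_ hd
  have hmul := mul_le_mul_of_nonneg_right hsuper (mul_pos (mul_pos hc0 hA) (neg_pos.2 hB)).le
  linear_combination hmul - c * Real.log r * hLs - c * Real.log s * hLr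
    + (r - s) * Real.log r * Real.log s * hc

theorem weighted_sq_mul_log_le_of_one_le (hr : 1 ≤ r) (a b : ℝ) :
    q * a ^ 2 * Real.log r + p * b ^ 2 * Real.log s ≤ c * (p * q * (a - b) ^ 2) := by
  have hc0 : 0 < c := pos_of_mul_pos_left (hc ▸ one_pos) (logMean_pos hp hq).le
  rcases hr.eq_or_lt with rfl | hr
  · have hs1 : s = 1 := mul_left_cancel₀ hp.ne' (by linarith)
    simpa [hs1] using show 0 ≤ c * (p * q * (a - b) ^ 2) by positivity
  have hkey := mul_weighted_log_le_log_mul_log hp hq hpq hc hs hrs hr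
  have hB : Real.log s ≤ 0 := Real.log_nonpos hs.le (by nlinarith)
  have hprod : c ^ 2 * (p * q) ≤ (c * p - Real.log r) * (c * q - Real.log s) := by linarith
  have hright : 0 < c * q - Real.log s := by linarith [mul_pos hc0 hq]
  have hleft : 0 < c * p - Real.log r :=
    pos_of_mul_pos_left (lt_of_lt_of_le (by positivity) hprod) hright.le
  have hform := quadratic_form_nonneg (α := q * (c * p - Real.log r)) (β := c * (p * q))
    (γ := p * (c * q - Real.log s)) (mul_pos hq hleft)
    (by linarith [mul_le_mul_of_nonneg_left hprod (mul_pos hp hq).le]) a b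
  linarith

end

theorem weighted_sq_mul_log_le {p r s : ℝ} (hp : 0 < p) (hp1 : p < 1) (hr : 0 < r) (hs : 0 < s)
    (hrs : (1 - p) * r + p * s = 1) (a b : ℝ) :
    (1 - p) * a ^ 2 * Real.log r + p * b ^ 2 * Real.log s
      ≤ cLS p * (p * (1 - p) * (a - b) ^ 2) := by
  have hq : 0 < 1 - p := sub_pos.2 hp1
  have hc := cLS_mul_logMean hp hp1
  rcases le_total 1 r with h1r | hr1
  · exact weighted_sq_mul_log_le_of_one_le hp hq (by ring) hc hs hrs h1r a b
  · have h1s : 1 ≤ s := le_of_mul_le_mul_left (by nlinarith) hp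
    have hswap := weighted_sq_mul_log_le_of_one_le hq hp (by ring) (by rwa [logMean_comm]) hr
      (by rwa [add_comm]) h1s b a
    linarith

theorem entBound_ber {p : I} (hp0 : 0 < p) (hp1 : p < 1) (g : Bool → ℝ) :
    EntBound (ber p) g (cLS p * Var[g; ber p]) := by
  intro ψ _ _
  have hp : (0 : ℝ) < p := hp0
  have hp' : (p : ℝ) < 1 := hp1
  have : (0 : ℝ) < 1 - p := sub_pos.2 hp'
  rw [variance_eq_integral (measurable_of_finite g).aemeasurable]
  simp only [ber, integral_bernoulliMeasure, smul_eq_mul]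
  set m := (p : ℝ) * Real.exp (ψ true) + (1 - p : ℝ) * Real.exp (ψ false) with hm
  have hm0 : 0 < m := by positivity
  have hnorm : (1 - p : ℝ) * (Real.exp (ψ false) / m) + p * (Real.exp (ψ true) / m) = 1 := by
    field_simp
    linarith [hm]
  have htwo := weighted_sq_mul_log_le hp hp' (by positivity) (by positivity) hnorm (g false)
    (g true)
  rw [Real.log_div (Real.exp_pos _).ne' hm0.ne', Real.log_div (Real.exp_pos _).ne' hm0.ne',
    Real.log_exp, Real.log_exp] at htwo
  linarith

end TwoPoint

/-! ### Weak derivatives on the real line -/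

theorem exists_tsupport_subset_Ioo {k : ℝ → ℝ} (hk : HasCompactSupport k) :
    ∃ R > 0, tsupport k ⊆ Set.Ioo (-R) R := by
  obtain ⟨R, hR, hball⟩ := hk.isCompact.isBounded.subset_ball_lt 0 0
  exact ⟨R, hR, by simpa [Real.ball_eq_Ioo] using hball⟩

theorem intervalIntegrable_of_locallyIntegrable {h : ℝ → ℝ}
    (hh : LocallyIntegrable h) (a b : ℝ) : IntervalIntegrable h volume a b :=
  (hh.integrableOn_isCompact isCompact_uIcc).intervalIntegrable

theorem integrable_mul_of_hasCompactSupport {u η : ℝ → ℝ} (hu : LocallyIntegrable u)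
    (hη : Continuous η) (hc : HasCompactSupport η) : Integrable fun x => η x * u x :=
  hu.integrable_smul_left_of_hasCompactSupport hη hc

theorem integral_deriv_mul_primitive {h : ℝ → ℝ} (hh : LocallyIntegrable h) {η : ℝ → ℝ}
    (hη : ContDiff ℝ ∞ η) (hc : HasCompactSupport η) :
    ∫ x, deriv η x * ∫ t in (0 : ℝ)..x, h t = - ∫ x, η x * h x := by
  obtain ⟨R, hR, hsupp⟩ := exists_tsupport_subset_Ioo hc
  have hη_right : η R = 0 := image_eq_zero_of_notMem_tsupport fun h => (hsupp h).2.false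
  have hη_left : η (-R) = 0 := image_eq_zero_of_notMem_tsupport fun h => (hsupp h).1.false
  have hη_ac : AbsolutelyContinuousOnInterval η (-R) R :=
    (hη.of_le (by exact_mod_cast le_top)).contDiffOn.absolutelyContinuousOnInterval
  have hprim_ac : AbsolutelyContinuousOnInterval (fun x => ∫ t in (0 : ℝ)..x, h t) (-R) R :=
    (intervalIntegrable_of_locallyIntegrable hh (-R) R
      ).absolutelyContinuousOnInterval_intervalIntegral (Set.mem_uIcc_of_le (by linarith) hR.le)
  have hparts := hη_ac.integral_mul_deriv_eq_deriv_mul hprim_ac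
  have hderiv : ∫ x in (-R)..R, η x * deriv (fun x => ∫ t in (0 : ℝ)..x, h t) x
      = ∫ x in (-R)..R, η x * h x := by
    apply intervalIntegral.integral_congr_ae
    filter_upwards [LocallyIntegrable.ae_hasDerivAt_integral hh] with x hx _
    rw [(hx 0).deriv]
  have hsupp' : ∀ {u v : ℝ → ℝ}, Function.support u ⊆ tsupport η →
      ∫ x in (-R)..R, u x * v x = ∫ x, u x * v x := fun hu =>
    intervalIntegral.integral_eq_integral_of_support_subset <|
      (Function.support_mul_subset_left _ _).trans
        (hu.trans (hsupp.trans Set.Ioo_subset_Ioc_self))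
  rw [hderiv, hη_right, hη_left, hsupp' (subset_tsupport η), hsupp' support_deriv_subset] at hparts
  linarith

theorem exists_hasCompactSupport_deriv_eq {k : ℝ → ℝ} (hk : ContDiff ℝ ∞ k)
    (hc : HasCompactSupport k) (hk_int : ∫ x, k x = 0) :
    ∃ ζ : ℝ → ℝ, ContDiff ℝ ∞ ζ ∧ HasCompactSupport ζ ∧ deriv ζ = k := by
  obtain ⟨R, -, hsupp⟩ := exists_tsupport_subset_Ioo hc
  replace hsupp : Function.support k ⊆ Set.Ioo (-R) R := (subset_tsupport k).trans hsupp
  have hd (x : ℝ) : HasDerivAt (fun x => ∫ t in (-R)..x, k t) (k x) x :=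
    intervalIntegral.integral_hasDerivAt_right (hk.continuous.intervalIntegrable _ _)
      hk.continuous.stronglyMeasurable.stronglyMeasurableAtFilter hk.continuous.continuousAt
  have hderiv : deriv (fun x => ∫ t in (-R)..x, k t) = k := funext fun x => (hd x).deriv
  refine ⟨fun x => ∫ t in (-R)..x, k t, ?_, ?_, hderiv⟩
  · rw [contDiff_infty_iff_deriv, hderiv]
    exact ⟨fun x => (hd x).differentiableAt, hk⟩
  · refine HasCompactSupport.intro (isCompact_Icc (a := -R) (b := R)) fun x hx => ?_
    rcases lt_or_ge x (-R) with hxR | hxR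
    · refine intervalIntegral.integral_zero_ae (ae_of_all _ fun t ht => ?_)
      rw [Set.uIoc_of_ge hxR.le] at ht
      exact Function.notMem_support.1 fun hkt => ((hsupp hkt).1.trans_le ht.2).false
    · have hRx : R < x := by
        by_contra! hle
        exact hx ⟨hxR, hle⟩
      rw [intervalIntegral.integral_eq_integral_of_support_subset
        fun t ht => ⟨(hsupp ht).1, (hsupp ht).2.le.trans hRx.le⟩, hk_int]

theorem ae_eq_const_of_integral_deriv_mul_eq_zero {u : ℝ → ℝ} (hu : LocallyIntegrable u)
    (h : ∀ η : ℝ → ℝ, ContDiff ℝ ∞ η → HasCompactSupport η → ∫ x, deriv η x * u x = 0) :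
    ∃ c, ∀ᵐ x, u x = c := by
  let b : ContDiffBump (0 : ℝ) := ⟨1, 2, one_pos, one_lt_two⟩
  set η₀ : ℝ → ℝ := b.normed volume
  have hη₀ : ContDiff ℝ ∞ η₀ := b.contDiff_normed
  have hη₀c : HasCompactSupport η₀ := b.hasCompactSupport_normed
  have hη₀_int : ∫ x, η₀ x = 1 := b.integral_normed
  refine ⟨∫ x, η₀ x * u x, ae_eq_of_integral_contDiff_smul_eq hu (locallyIntegrable_const _) ?_⟩
  intro η hη hηc
  -- Subtracting a multiple of the bump `η₀` makes `η` a derivative.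
  set m := ∫ x, η x
  have hk_int : ∫ x, (η x - m * η₀ x) = 0 := by
    rw [integral_sub (hη.continuous.integrable_of_hasCompactSupport hηc)
      ((hη₀.continuous.integrable_of_hasCompactSupport hη₀c).const_mul m), integral_const_mul,
      hη₀_int, mul_one, sub_self]
  obtain ⟨ζ, hζ, hζc, hζd⟩ := exists_hasCompactSupport_deriv_eq
    (hη.sub (contDiff_const.mul hη₀)) (hηc.sub (hη₀c.mul_left (f := fun _ => m))) hk_int
  calc ∫ x, η x • u x = ∫ x, (deriv ζ x * u x + m * (η₀ x * u x)) := by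
        simp only [hζd, smul_eq_mul]
        congr with x
        ring
    _ = m * ∫ x, η₀ x * u x := by
        rw [integral_add
          (integrable_mul_of_hasCompactSupport hu (hζ.continuous_deriv (by simp)) hζc.deriv)
          ((integrable_mul_of_hasCompactSupport hu hη₀.continuous hη₀c).const_mul m),
          h ζ hζ hζc, zero_add, integral_const_mul]
    _ = ∫ x, η x • ∫ x, η₀ x * u x := (integral_smul_const η _).symm

theorem HasWeakDeriv.exists_ae_eq_const_add_integral {f h : ℝ → ℝ} (H : HasWeakDeriv f h) :
    ∃ c, ∀ᵐ x, f x = c + ∫ t in (0 : ℝ)..x, h t := by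
  obtain ⟨hf, hh, hw⟩ := H
  have hcont : Continuous fun x => ∫ t in (0 : ℝ)..x, h t :=
    intervalIntegral.continuous_primitive (intervalIntegrable_of_locallyIntegrable hh) 0
  have hweak (η : ℝ → ℝ) (hη : ContDiff ℝ ∞ η) (hηc : HasCompactSupport η) :
      ∫ x, deriv η x * (f x - ∫ t in (0 : ℝ)..x, h t) = 0 := by
    have hη' : Continuous (deriv η) := hη.continuous_deriv (by simp)
    simp_rw [mul_sub]
    rw [integral_sub (integrable_mul_of_hasCompactSupport hf hη' hηc.deriv)
        (integrable_mul_of_hasCompactSupport hcont.locallyIntegrable hη' hηc.deriv),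
      integral_deriv_mul_primitive hh hη hηc, hw η hη hηc, sub_neg_eq_add, add_neg_cancel]
  obtain ⟨c, hc⟩ :=
    ae_eq_const_of_integral_deriv_mul_eq_zero (hf.sub hcont.locallyIntegrable) hweak
  exact ⟨c, hc.mono fun x hx => sub_eq_iff_eq_add.1 hx⟩

/-! ### The Gaussian logarithmic Sobolev inequality on the line -/

/-- The density of the standard Gaussian measure. -/
def phi (x : ℝ) : ℝ := gaussianPDFReal 0 1 x

theorem phi_eq (x : ℝ) : phi x = (√(2 * Real.pi))⁻¹ * Real.exp (-x ^ 2 / 2) := by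
  simp [phi, gaussianPDFReal]

theorem phi_pos (x : ℝ) : 0 < phi x := gaussianPDFReal_pos 0 1 x one_ne_zero

theorem phi_le_phi_zero (x : ℝ) : phi x ≤ phi 0 := by
  rw [phi_eq, phi_eq]
  gcongr _ * Real.exp ?_
  nlinarith [sq_nonneg x]

theorem log_phi (x : ℝ) : Real.log (phi x) = Real.log (√(2 * Real.pi))⁻¹ + -x ^ 2 / 2 := by
  rw [phi_eq, Real.log_mul (by positivity) (Real.exp_pos _).ne', Real.log_exp]

theorem hasDerivAt_phi (x : ℝ) : HasDerivAt phi (-x * phi x) x := by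
  have hexponent : HasDerivAt (fun x : ℝ => -x ^ 2 / 2) (-x) x := by
    convert! ((hasDerivAt_pow 2 x).neg).div_const 2 using 1
    ring
  rw [phi_eq x, funext phi_eq]
  convert! hexponent.exp.const_mul _ using 1
  ring

theorem contDiff_phi : ContDiff ℝ ∞ phi := by
  rw [funext phi_eq]
  fun_prop

theorem integrable_phi : Integrable phi := integrable_gaussianPDFReal 0 1

theorem integral_phi : ∫ x, phi x = 1 := integral_gaussianPDFReal_eq_one 0 one_ne_zero

theorem integral_gauss (f : ℝ → ℝ) : ∫ x, f x ∂gauss = ∫ x, f x * phi x := by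
  rw [gauss, integral_gaussianReal_eq_integral_smul one_ne_zero]
  simp only [smul_eq_mul, mul_comm]
  rfl

theorem integrable_gauss_iff {f : ℝ → ℝ} :
    Integrable f gauss ↔ Integrable fun x => f x * phi x := by
  rw [gauss, gaussianReal_of_var_ne_zero _ one_ne_zero, integrable_withDensity_iff
    (measurable_gaussianPDF _ _) (ae_of_all _ fun _ => gaussianPDF_lt_top)]
  simp only [toReal_gaussianPDF]
  rfl

theorem intervalIntegral_mul_phi (f : ℝ → ℝ) {a b : ℝ} (hab : a ≤ b) :
    ∫ x in a..b, f x * phi x = ∫ x in Set.Ioc a b, f x ∂gauss := by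
  rw [intervalIntegral.integral_of_le hab, ← integral_indicator measurableSet_Ioc,
    ← integral_indicator measurableSet_Ioc, integral_gauss]
  congr with x
  rw [Set.indicator_mul_left]

theorem intervalIntegrable_mul_phi_iff {f : ℝ → ℝ} {a b : ℝ} (hab : a ≤ b) :
    IntervalIntegrable (fun x => f x * phi x) volume a b ↔ IntegrableOn f (Set.Ioc a b) gauss := by
  rw [intervalIntegrable_iff_integrableOn_Ioc_of_le hab, ← integrable_indicator_iff
    measurableSet_Ioc, ← integrable_indicator_iff measurableSet_Ioc, integrable_gauss_iff]
  exact integrable_congr (ae_of_all _ fun x => Set.indicator_mul_left _ f phi)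

instance : IsProbabilityMeasure gauss := by unfold gauss; infer_instance

theorem gauss_absolutelyContinuous : gauss ≪ volume :=
  gaussianReal_absolutelyContinuous 0 one_ne_zero

theorem volume_absolutelyContinuous_gauss : (volume : Measure ℝ) ≪ gauss :=
  gaussianReal_absolutelyContinuous' 0 one_ne_zero

/-- The distribution function of the measure with density `w` with respect to Lebesgue measure. -/
def distribFun (w : ℝ → ℝ) (x : ℝ) : ℝ := ∫ t in Set.Iic x, w t

section DistribFun

variable {w : ℝ → ℝ} (hw : Integrable w)
include hw

theorem distribFun_sub (x y : ℝ) : distribFun w y - distribFun w x = ∫ t in x..y, w t :=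
  intervalIntegral.integral_Iic_sub_Iic hw.integrableOn hw.integrableOn

theorem distribFun_eq_add_intervalIntegral :
    distribFun w = fun x => distribFun w 0 + ∫ t in (0 : ℝ)..x, w t := by
  funext x
  rw [← distribFun_sub hw, add_sub_cancel]

theorem continuous_distribFun : Continuous (distribFun w) := by
  rw [distribFun_eq_add_intervalIntegral hw]
  exact continuous_const.add
    (intervalIntegral.continuous_primitive (fun _ _ => hw.intervalIntegrable) 0)

theorem ae_hasDerivAt_distribFun : ∀ᵐ x, HasDerivAt (distribFun w) (w x) x := by
  filter_upwards [LocallyIntegrable.ae_hasDerivAt_integral hw.locallyIntegrable] with x hx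
  rw [distribFun_eq_add_intervalIntegral hw]
  exact (hx 0).const_add _

theorem tendsto_distribFun_atTop : Tendsto (distribFun w) atTop (𝓝 (∫ x, w x)) :=
  (aecover_Iic tendsto_id).integral_tendsto_of_countably_generated hw

theorem tendsto_distribFun_atBot : Tendsto (distribFun w) atBot (𝓝 0) := by
  have hIoi : Tendsto (fun x => ∫ t in Set.Ioi x, w t) atBot (𝓝 (∫ t, w t)) :=
    (aecover_Ioi tendsto_id).integral_tendsto_of_countably_generated hw
  refine (sub_self (∫ t, w t) ▸ hIoi.const_sub (∫ t, w t)).congr fun x => ?_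
  rw [distribFun, ← intervalIntegral.integral_Iic_add_Ioi hw.integrableOn hw.integrableOn (b := x),
    add_sub_cancel_right]

variable (hpos : ∀ x, 0 < w x)
include hpos

theorem strictMono_distribFun : StrictMono (distribFun w) := by
  intro x y hxy
  rw [← sub_pos, distribFun_sub hw]
  exact intervalIntegral.intervalIntegral_pos_of_pos hw.intervalIntegrable hpos hxy

theorem distribFun_mem_Ioo (x : ℝ) : distribFun w x ∈ Set.Ioo 0 (∫ x, w x) := by
  have hmono := strictMono_distribFun hw hpos
  constructor
  · exact (hmono.monotone.le_of_tendsto (tendsto_distribFun_atBot hw) (x - 1)).trans_lt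
      (hmono (sub_one_lt x))
  · exact (hmono (lt_add_one x)).trans_le
      (hmono.monotone.ge_of_tendsto (tendsto_distribFun_atTop hw) (x + 1))

end DistribFun

theorem hasDerivAt_distribFun_phi (x : ℝ) : HasDerivAt (distribFun phi) (phi x) x := by
  rw [distribFun_eq_add_intervalIntegral integrable_phi]
  exact (contDiff_phi.continuous.integral_hasStrictDerivAt 0 x).hasDerivAt.const_add _

/-- `T` is the monotone transport to the standard Gaussian measure of the measure with density `v`;
since `T` is increasing, this is expressed through the distribution functions. -/
def IsGaussTransport (v T : ℝ → ℝ) : Prop := ∀ x, distribFun phi (T x) = distribFun v x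

section Transport

variable {v : ℝ → ℝ} (hv : Integrable v)
include hv

theorem exists_isGaussTransport (hpos : ∀ x, 0 < v x) (hv_int : ∫ x, v x = 1) :
    ∃ T, IsGaussTransport v T := by
  suffices h : ∀ x, ∃ y, distribFun phi y = distribFun v x from Classical.axiomOfChoice h
  intro x
  obtain ⟨hlow, hupp⟩ := distribFun_mem_Ioo hv hpos x
  rw [hv_int, ← integral_phi] at hupp
  exact mem_range_of_exists_le_of_exists_ge (continuous_distribFun integrable_phi)
    ((tendsto_distribFun_atBot integrable_phi).eventually_le_const hlow).exists
    ((tendsto_distribFun_atTop integrable_phi).eventually_const_le hupp).exists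

namespace IsGaussTransport

variable {T : ℝ → ℝ} (hT : IsGaussTransport v T)
include hT

theorem monotone (hpos : ∀ x, 0 < v x) : Monotone T := fun x y hxy => by
  rw [← (strictMono_distribFun integrable_phi phi_pos).le_iff_le, hT, hT]
  exact (strictMono_distribFun hv hpos).monotone hxy

theorem phi_mul_deriv_ae_eq :
    ∀ᵐ x, DifferentiableAt ℝ T x → phi (T x) * deriv T x = v x := by
  filter_upwards [ae_hasDerivAt_distribFun hv] with x hx hd
  have hcomp := (hasDerivAt_distribFun_phi (T x)).comp x hd.hasDerivAt
  rw [show distribFun phi ∘ T = distribFun v from funext hT] at hcomp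
  exact hcomp.unique hx

theorem mul_sub_le_mul_sub {x y m b : ℝ} (hxy : x ≤ y) (hTxy : T x ≤ T y)
    (hm : ∀ t ∈ Set.Icc (T x) (T y), m ≤ phi t) (hb : ∀ t ∈ Set.Icc x y, v t ≤ b) :
    m * (T y - T x) ≤ b * (y - x) :=
  calc m * (T y - T x) = ∫ _ in (T x)..(T y), m := by simp [mul_comm]
    _ ≤ ∫ t in (T x)..(T y), phi t :=
        intervalIntegral.integral_mono_on hTxy intervalIntegrable_const
          integrable_phi.intervalIntegrable hm
    _ = ∫ t in x..y, v t := by rw [← distribFun_sub integrable_phi, ← distribFun_sub hv, hT, hT]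
    _ ≤ ∫ _ in x..y, b :=
        intervalIntegral.integral_mono_on hxy hv.intervalIntegrable intervalIntegrable_const hb
    _ = b * (y - x) := by simp [mul_comm]

theorem absolutelyContinuousOnInterval (hpos : ∀ x, 0 < v x) {b : ℝ} (hb : ∀ x, v x ≤ b)
    {α β : ℝ} (hαβ : α ≤ β) : AbsolutelyContinuousOnInterval T α β := by
  have hmono := hT.monotone hv hpos
  obtain ⟨y₀, -, hy₀⟩ := (isCompact_Icc (a := T α) (b := T β)).exists_isMinOn
    ⟨T α, le_rfl, hmono hαβ⟩ contDiff_phi.continuous.continuousOn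
  have hb_pos : 0 < b := (hpos 0).trans_le (hb 0)
  have hlip {x y : ℝ} (hx : x ∈ Set.Icc α β) (hy : y ∈ Set.Icc α β) (hxy : x ≤ y) :
      dist (T x) (T y) ≤ b / phi y₀ * dist x y := by
    rw [dist_comm, dist_comm x, Real.dist_eq, Real.dist_eq,
      abs_of_nonneg (sub_nonneg.2 (hmono hxy)), abs_of_nonneg (sub_nonneg.2 hxy),
      div_mul_eq_mul_div, le_div_iff₀ (phi_pos y₀), mul_comm]
    exact hT.mul_sub_le_mul_sub hv hxy (hmono hxy)
      (fun t ht => hy₀ ⟨(hmono hx.1).trans ht.1, ht.2.trans (hmono hy.2)⟩) fun t _ => hb t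
  apply LipschitzOnWith.absolutelyContinuousOnInterval
    (K := ⟨b / phi y₀, (div_pos hb_pos (phi_pos y₀)).le⟩)
  rw [Set.uIcc_of_le hαβ]
  refine LipschitzOnWith.of_dist_le_mul fun x hx y hy => ?_
  rcases le_total x y with hxy | hxy
  · exact hlip hx hy hxy
  · rw [dist_comm, dist_comm x]
    exact hlip hy hx hxy

end IsGaussTransport

end Transport

theorem log_le_of_phi_mul_eq {w x y d : ℝ} (hw : 0 < w) (hd : phi y * d = w * phi x) :
    Real.log w ≤ (x ^ 2 - y ^ 2) / 2 + (d - 1) := by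
  have hd_pos : 0 < d :=
    pos_of_mul_pos_right (hd ▸ mul_pos hw (phi_pos x)) (phi_pos y).le
  have hlog : Real.log (phi y) + Real.log d = Real.log w + Real.log (phi x) := by
    rw [← Real.log_mul (phi_pos y).ne' hd_pos.ne', hd, Real.log_mul hw.ne' (phi_pos x).ne']
  rw [log_phi, log_phi] at hlog
  linarith [Real.log_le_sub_one_of_pos hd_pos]

-- After integration by parts, the first two terms on the right integrate to zero.
theorem sq_mul_log_mul_phi_le {w x y d : ℝ} (hw : 0 < w) (hd : phi y * d = w * phi x) (g g' : ℝ) :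
    g ^ 2 * Real.log w * phi x ≤ 2 * (g * g') * ((y - x) * phi x)
      + g * g * ((d - 1) * phi x + (y - x) * (-x * phi x)) + 2 * (g' ^ 2 * phi x) := by
  have hlog := mul_le_mul_of_nonneg_left (log_le_of_phi_mul_eq hw hd)
    (mul_nonneg (sq_nonneg g) (phi_pos x).le)
  have hsquare : 0 ≤ 2 * (g' + g * (y - x) / 2) ^ 2 * phi x :=
    mul_nonneg (by positivity) (phi_pos x).le
  linear_combination hlog + hsquare

theorem IsGaussTransport.ae_sq_mul_log_mul_phi_le {w T : ℝ → ℝ} (hw : ∀ x, 0 < w x)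
    (hwφ : Integrable fun x => w x * phi x) (hT : IsGaussTransport (fun x => w x * phi x) T)
    {α β : ℝ} (hT_ac : AbsolutelyContinuousOnInterval T α β) {g : ℝ → ℝ}
    (hg : AbsolutelyContinuousOnInterval g α β) :
    ∀ᵐ x, x ∈ Set.uIcc α β → g x ^ 2 * Real.log (w x) * phi x
      ≤ deriv (fun x => g x * g x) x * ((T x - x) * phi x)
        + g x * g x * deriv (fun x => (T x - x) * phi x) x + 2 * (deriv g x ^ 2 * phi x) := by
  filter_upwards [hT.phi_mul_deriv_ae_eq hwφ, hT_ac.ae_differentiableAt, hg.ae_differentiableAt]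
    with x hTx hT_diff hg_diff hx
  have hT_deriv := (hT_diff hx).hasDerivAt
  have hg_deriv := (hg_diff hx).hasDerivAt
  have hgg_deriv : deriv (fun x => g x * g x) x = 2 * (g x * deriv g x) :=
    (hg_deriv.mul hg_deriv).deriv.trans (by ring)
  have hF_deriv : deriv (fun x => (T x - x) * phi x) x
      = (deriv T x - 1) * phi x + (T x - x) * (-x * phi x) :=
    ((hT_deriv.sub (hasDerivAt_id x)).mul (hasDerivAt_phi x)).deriv
  rw [hgg_deriv, hF_deriv]
  exact sq_mul_log_mul_phi_le (hw x) (hTx (hT_diff hx)) (g x) (deriv g x)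

theorem setIntegral_sq_mul_log_le {w : ℝ → ℝ} (hw : Measurable w) {a b : ℝ} (ha : 0 < a)
    (hab : ∀ x, w x ∈ Set.Icc a b) (hw_int : ∫ x, w x ∂gauss = 1) {α β : ℝ} (hαβ : α ≤ β)
    {g : ℝ → ℝ} (hg : AbsolutelyContinuousOnInterval g α β) (hg_left : g α = 0) (hg_right : g β = 0)
    (hg' : IntegrableOn (fun x => deriv g x ^ 2) (Set.Ioc α β) gauss) :
    ∫ x in Set.Ioc α β, g x ^ 2 * Real.log (w x) ∂gauss
      ≤ 2 * ∫ x in Set.Ioc α β, deriv g x ^ 2 ∂gauss := by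
  have hw_pos (x : ℝ) : 0 < w x := ha.trans_le (hab x).1
  have hv_pos (x : ℝ) : 0 < w x * phi x := mul_pos (hw_pos x) (phi_pos x)
  have hv : Integrable fun x => w x * phi x := integrable_gauss_iff.1
    (.of_mem_Icc a b hw.aemeasurable (ae_of_all _ hab))
  obtain ⟨T, hT⟩ := exists_isGaussTransport hv hv_pos (by rw [← integral_gauss, hw_int])
  have hT_ac : AbsolutelyContinuousOnInterval T α β := hT.absolutelyContinuousOnInterval hv hv_pos
    (fun x => mul_le_mul (hab x).2 (phi_le_phi_zero x) (phi_pos x).le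
      ((hw_pos x).le.trans (hab x).2)) hαβ
  set F : ℝ → ℝ := fun x => (T x - x) * phi x
  have hF : AbsolutelyContinuousOnInterval F α β :=
    (hT_ac.fun_sub contDiff_id.contDiffOn.absolutelyContinuousOnInterval).fun_mul
      (contDiff_phi.of_le (by exact_mod_cast le_top)).contDiffOn.absolutelyContinuousOnInterval
  have hgg : AbsolutelyContinuousOnInterval (fun x => g x * g x) α β := hg.fun_mul hg
  have hparts_int : IntervalIntegrable (fun x => deriv (fun x => g x * g x) x * F x
      + g x * g x * deriv F x) volume α β :=
    (hgg.intervalIntegrable_deriv.mul_continuousOn hF.continuousOn).add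
      (hF.intervalIntegrable_deriv.continuousOn_mul hgg.continuousOn)
  have hparts : ∫ x in α..β, (deriv (fun x => g x * g x) x * F x + g x * g x * deriv F x) = 0 := by
    simpa [hg_left, hg_right] using hgg.integral_deriv_mul_eq_sub hF
  have hlog_int : IntegrableOn (fun x => g x ^ 2 * Real.log (w x)) (Set.Ioc α β) gauss := by
    have hsq : IntegrableOn (fun x => g x ^ 2) (Set.Ioc α β) gauss :=
      (((hg.continuousOn.mono Set.Icc_subset_uIcc).pow 2).integrableOn_Icc).mono_set
        Set.Ioc_subset_Icc_self
    exact hsq.mul_bdd hw.log.aestronglyMeasurable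
      (ae_of_all _ fun x => abs_log_le_max_abs_log ha (hab x))
  rw [← intervalIntegrable_mul_phi_iff hαβ] at hg' hlog_int
  rw [← intervalIntegral_mul_phi _ hαβ, ← intervalIntegral_mul_phi _ hαβ]
  calc ∫ x in α..β, g x ^ 2 * Real.log (w x) * phi x
      ≤ ∫ x in α..β, ((deriv (fun x => g x * g x) x * F x + g x * g x * deriv F x)
          + 2 * (deriv g x ^ 2 * phi x)) := by
        apply intervalIntegral.integral_mono_ae_restrict hαβ hlog_int
          (hparts_int.add (hg'.const_mul 2))
        rw [EventuallyLE, ae_restrict_iff' measurableSet_Icc, ← Set.uIcc_of_le hαβ]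
        exact hT.ae_sq_mul_log_mul_phi_le hw_pos hv hT_ac hg
    _ = 2 * ∫ x in α..β, deriv g x ^ 2 * phi x := by
      rw [intervalIntegral.integral_add hparts_int (hg'.const_mul 2), hparts, zero_add,
        intervalIntegral.integral_const_mul]

theorem tendsto_setIntegral_Ioc_of_dominated_convergence {μ : Measure ℝ} {F : ℝ → ℝ → ℝ}
    {f bound : ℝ → ℝ} (hF : ∀ R, AEStronglyMeasurable (F R) μ) (hbound : Integrable bound μ)
    (hle : ∀ᶠ R in atTop, ∀ x ∈ Set.Ioc (-R) R, |F R x| ≤ bound x)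
    (hlim : ∀ x, Tendsto (fun R => F R x) atTop (𝓝 (f x))) :
    Tendsto (fun R => ∫ x in Set.Ioc (-R) R, F R x ∂μ) atTop (𝓝 (∫ x, f x ∂μ)) := by
  simp_rw [← integral_indicator measurableSet_Ioc]
  refine tendsto_integral_filter_of_dominated_convergence (fun x => |bound x|)
    (.of_forall fun R => (hF R).indicator measurableSet_Ioc) ?_ hbound.abs (ae_of_all _ fun x => ?_)
  · filter_upwards [hle] with R hR
    refine ae_of_all _ fun x => ?_
    by_cases hx : x ∈ Set.Ioc (-R) R
    · rw [Set.indicator_of_mem hx]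
      exact (hR x hx).trans (le_abs_self _)
    · rw [Set.indicator_of_notMem hx, norm_zero]
      exact abs_nonneg _
  · refine (hlim x).congr' ?_
    filter_upwards [eventually_gt_atTop |x|] with R hR
    have hx : x ∈ Set.Ioc (-R) R := ⟨(abs_lt.1 hR).1, (abs_lt.1 hR).2.le⟩
    rw [Set.indicator_of_mem hx]

/-- A Lipschitz cut-off of the interval `[-R, R]`, increasing to `1` as `R` tends to infinity. -/
def cutoff (R x : ℝ) : ℝ := 1 - x ^ 2 / R ^ 2

section Cutoff

variable {R x : ℝ}

theorem cutoff_self (hR : R ≠ 0) : cutoff R R = 0 := by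
  simp [cutoff, hR]

theorem cutoff_neg_self (hR : R ≠ 0) : cutoff R (-R) = 0 := by
  simp [cutoff, hR]

theorem contDiff_cutoff (R : ℝ) : ContDiff ℝ 1 (cutoff R) := by
  unfold cutoff
  fun_prop

theorem hasDerivAt_cutoff (R x : ℝ) : HasDerivAt (cutoff R) (-(2 * x / R ^ 2)) x := by
  convert! ((hasDerivAt_pow 2 x).div_const (R ^ 2)).const_sub 1 using 1
  simp

theorem sq_cutoff_le_one (hx : x ∈ Set.Ioc (-R) R) : cutoff R x ^ 2 ≤ 1 := by
  have hle : x ^ 2 / R ^ 2 ≤ 1 :=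
    div_le_one_of_le₀ (sq_le_sq' hx.1.le hx.2) (sq_nonneg R)
  have hnonneg : 0 ≤ x ^ 2 / R ^ 2 := by positivity
  exact pow_le_one₀ (sub_nonneg.2 hle) (sub_le_self 1 hnonneg)

theorem sq_two_mul_div_sq_le (hR : 1 ≤ R) (hx : x ∈ Set.Ioc (-R) R) :
    (2 * x / R ^ 2) ^ 2 ≤ 4 := by
  have hsq : x ^ 2 ≤ R ^ 2 := sq_le_sq' hx.1.le hx.2
  rw [div_pow, div_le_iff₀ (by positivity)]
  nlinarith [one_le_pow₀ hR (n := 2)]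

theorem sq_cutoff_mul_sub_le (hR : 1 ≤ R) (hx : x ∈ Set.Ioc (-R) R) (a b : ℝ) :
    (cutoff R x * a - 2 * x / R ^ 2 * b) ^ 2 ≤ 2 * a ^ 2 + 8 * b ^ 2 := by
  have ha := mul_le_mul_of_nonneg_right (sq_cutoff_le_one hx) (sq_nonneg a)
  have hb := mul_le_mul_of_nonneg_right (sq_two_mul_div_sq_le hR hx) (sq_nonneg b)
  nlinarith [sq_nonneg (cutoff R x * a + 2 * x / R ^ 2 * b)]

theorem tendsto_div_sq_atTop (c : ℝ) : Tendsto (fun R : ℝ => c / R ^ 2) atTop (𝓝 0) :=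
  (tendsto_pow_atTop two_ne_zero).const_div_atTop c

theorem tendsto_cutoff (x : ℝ) : Tendsto (fun R => cutoff R x) atTop (𝓝 1) := by
  simpa [cutoff] using (tendsto_div_sq_atTop (x ^ 2)).const_sub 1

end Cutoff

section Primitive

variable {w : ℝ → ℝ} (hw : Measurable w) {a b : ℝ} (ha : 0 < a) (hab : ∀ x, w x ∈ Set.Icc a b)
  (hw_int : ∫ x, w x ∂gauss = 1) {h G : ℝ → ℝ} (hh : LocallyIntegrable h) (hh₂ : MemLp h 2 gauss)
  {c : ℝ} (hG : ∀ x, G x = c + ∫ t in (0 : ℝ)..x, h t) (hG₂ : MemLp G 2 gauss)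
include hw ha hab hw_int hh hh₂ hG hG₂

theorem setIntegral_sq_cutoff_mul_log_le {R : ℝ} (hR : 1 ≤ R) :
    ∫ x in Set.Ioc (-R) R, (cutoff R x * G x) ^ 2 * Real.log (w x) ∂gauss
      ≤ 2 * ∫ x in Set.Ioc (-R) R, (cutoff R x * h x - 2 * x / R ^ 2 * G x) ^ 2 ∂gauss := by
  have hle : -R ≤ R := by linarith
  have hR_ne : R ≠ 0 := by linarith
  have hG_ac : AbsolutelyContinuousOnInterval G (-R) R := by
    rw [funext hG]
    exact contDiff_const.contDiffOn.absolutelyContinuousOnInterval.fun_add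
      ((intervalIntegrable_of_locallyIntegrable hh _ _
        ).absolutelyContinuousOnInterval_intervalIntegral
          (Set.mem_uIcc_of_le (by linarith) (by linarith)))
  have hg_ac : AbsolutelyContinuousOnInterval (fun x => cutoff R x * G x) (-R) R :=
    (contDiff_cutoff R).contDiffOn.absolutelyContinuousOnInterval.fun_mul hG_ac
  have hderiv : ∀ᵐ x ∂gauss.restrict (Set.Ioc (-R) R),
      deriv (fun x => cutoff R x * G x) x ^ 2
        = (cutoff R x * h x - 2 * x / R ^ 2 * G x) ^ 2 := by
    refine ae_restrict_of_ae (gauss_absolutelyContinuous.ae_le ?_)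
    filter_upwards [LocallyIntegrable.ae_hasDerivAt_integral hh] with x hx
    have hGx : HasDerivAt G (h x) x := by
      rw [funext hG]
      exact (hx 0).const_add c
    rw [((hasDerivAt_cutoff R x).fun_mul hGx).deriv]
    ring
  have hsq_int : IntegrableOn (fun x => (cutoff R x * h x - 2 * x / R ^ 2 * G x) ^ 2)
      (Set.Ioc (-R) R) gauss := by
    refine ((hh₂.integrable_sq.const_mul 2).add
      (hG₂.integrable_sq.const_mul 8)).integrableOn.mono' ?_ ?_
    · exact ((((contDiff_cutoff R).continuous.aestronglyMeasurable.mul hh₂.1).sub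
        ((by fun_prop : Continuous fun x => 2 * x / R ^ 2).aestronglyMeasurable.mul
          hG₂.1)).pow 2).restrict
    · filter_upwards [ae_restrict_mem measurableSet_Ioc] with x hx
      rw [Real.norm_eq_abs, abs_sq]
      exact sq_cutoff_mul_sub_le hR hx (h x) (G x)
  rw [← integral_congr_ae hderiv]
  exact setIntegral_sq_mul_log_le hw ha hab hw_int hle hg_ac (by simp [cutoff_neg_self hR_ne])
    (by simp [cutoff_self hR_ne]) (hsq_int.congr (hderiv.mono fun x hx => hx.symm))

theorem integral_sq_mul_log_le_of_eq_primitive :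
    ∫ x, G x ^ 2 * Real.log (w x) ∂gauss ≤ 2 * ∫ x, h x ^ 2 ∂gauss := by
  have hχ (R : ℝ) : AEStronglyMeasurable (cutoff R) gauss :=
    (contDiff_cutoff R).continuous.aestronglyMeasurable
  have hχ' (R : ℝ) : AEStronglyMeasurable (fun x => 2 * x / R ^ 2) gauss :=
    (by fun_prop : Continuous fun x => 2 * x / R ^ 2).aestronglyMeasurable
  have hlim_log : Tendsto
      (fun R => ∫ x in Set.Ioc (-R) R, (cutoff R x * G x) ^ 2 * Real.log (w x) ∂gauss) atTop
      (𝓝 (∫ x, G x ^ 2 * Real.log (w x) ∂gauss)) := by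
    refine tendsto_setIntegral_Ioc_of_dominated_convergence
      (fun R => (((hχ R).mul hG₂.1).pow 2).mul hw.log.aestronglyMeasurable)
      (hG₂.integrable_sq.mul_const (max |Real.log a| |Real.log b|))
      (.of_forall fun R x hx => ?_) fun x => ?_
    · rw [abs_mul, abs_sq, mul_pow]
      exact mul_le_mul (mul_le_of_le_one_left (sq_nonneg _) (sq_cutoff_le_one hx))
        (abs_log_le_max_abs_log ha (hab x)) (abs_nonneg _) (sq_nonneg _)
    · simpa using (((tendsto_cutoff x).mul_const (G x)).pow 2).mul_const (Real.log (w x))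
  have hlim_deriv : Tendsto
      (fun R => ∫ x in Set.Ioc (-R) R, (cutoff R x * h x - 2 * x / R ^ 2 * G x) ^ 2 ∂gauss) atTop
      (𝓝 (∫ x, h x ^ 2 ∂gauss)) := by
    refine tendsto_setIntegral_Ioc_of_dominated_convergence
      (fun R => (((hχ R).mul hh₂.1).sub ((hχ' R).mul hG₂.1)).pow 2)
      ((hh₂.integrable_sq.const_mul 2).add (hG₂.integrable_sq.const_mul 8)) ?_ fun x => ?_
    · filter_upwards [eventually_ge_atTop 1] with R hR x hx
      rw [abs_sq]
      exact sq_cutoff_mul_sub_le hR hx (h x) (G x)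
    · simpa using (((tendsto_cutoff x).mul_const (h x)).sub
        ((tendsto_div_sq_atTop (2 * x)).mul_const (G x))).pow 2
  refine le_of_tendsto_of_tendsto hlim_log (hlim_deriv.const_mul 2) ?_
  filter_upwards [eventually_ge_atTop 1] with R hR
  exact setIntegral_sq_cutoff_mul_log_le hw ha hab hw_int hh hh₂ hG hG₂ hR

end Primitive

theorem entBound_of_integral_sq_mul_log_le {X : Type*} [MeasurableSpace X] {μ : Measure X}
    [IsProbabilityMeasure μ] {g : X → ℝ} (hg : MemLp g 2 μ) {E : ℝ}
    (h : ∀ (w : X → ℝ) (a b : ℝ), Measurable w → 0 < a → (∀ x, w x ∈ Set.Icc a b) →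
      ∫ x, w x ∂μ = 1 → ∫ x, g x ^ 2 * Real.log (w x) ∂μ ≤ E) :
    EntBound μ g E := by
  rintro ψ hψ ⟨C, hC⟩
  set m := ∫ x, Real.exp (ψ x) ∂μ with hm
  have hm_pos : 0 < m := integral_exp_pos
    (.of_bound hψ.exp.aestronglyMeasurable (Real.exp C) (ae_of_all _ fun x => by
      rw [Real.norm_eq_abs, Real.abs_exp]
      exact Real.exp_le_exp.2 (abs_le.1 (hC x)).2))
  have hle := h (fun x => Real.exp (ψ x - Real.log m)) (Real.exp (-C - Real.log m))
    (Real.exp (C - Real.log m)) (hψ.sub_const _).exp (Real.exp_pos _)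
    (fun x => ⟨Real.exp_le_exp.2 (sub_le_sub_right (abs_le.1 (hC x)).1 _),
      Real.exp_le_exp.2 (sub_le_sub_right (abs_le.1 (hC x)).2 _)⟩)
    (by simp only [Real.exp_sub, Real.exp_log hm_pos]
        rw [integral_div, ← hm, div_self hm_pos.ne'])
  simp_rw [Real.log_exp, mul_sub] at hle
  rw [integral_sub (hg.integrable_sq.mul_bdd hψ.aestronglyMeasurable (ae_of_all _ hC))
    (hg.integrable_sq.mul_const _), integral_mul_const] at hle
  linarith

theorem entBound_gauss {f h : ℝ → ℝ} (hf : MemLp f 2 gauss) (hh : MemLp h 2 gauss)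
    (H : HasWeakDeriv f h) : EntBound gauss f (2 * ∫ x, h x ^ 2 ∂gauss) := by
  obtain ⟨c, hc⟩ := H.exists_ae_eq_const_add_integral
  have hfG := gauss_absolutelyContinuous.ae_eq hc
  refine entBound_of_integral_sq_mul_log_le hf fun w a b hw ha hab hw_int => ?_
  calc ∫ x, f x ^ 2 * Real.log (w x) ∂gauss
      = ∫ x, (c + ∫ t in (0 : ℝ)..x, h t) ^ 2 * Real.log (w x) ∂gauss :=
        integral_congr_ae (by filter_upwards [hfG] with x hx; rw [hx])
    _ ≤ 2 * ∫ x, h x ^ 2 ∂gauss :=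
        integral_sq_mul_log_le_of_eq_primitive hw ha hab hw_int H.2.1 hh (fun _ => rfl)
          ((memLp_congr_ae hfG).1 hf)

/-! ### Operations on weak derivatives -/

theorem locallyIntegrable_of_integrable_gauss {f : ℝ → ℝ} (hf : Integrable f gauss) :
    LocallyIntegrable f := by
  rw [locallyIntegrable_iff]
  intro k hk
  have hcont : ContinuousOn (fun x => (phi x)⁻¹) k :=
    (contDiff_phi.continuous.inv₀ fun x => (phi_pos x).ne').continuousOn
  refine ((integrable_gauss_iff.1 hf).integrableOn.mul_continuousOn hcont hk).congr_fun
    (fun x _ => ?_) hk.measurableSet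
  exact mul_inv_cancel_right₀ (phi_pos x).ne' (f x)

theorem integrable_prod_gauss_iff {Ω : Type*} [MeasurableSpace Ω] {ν : Measure Ω} [SFinite ν]
    {F : Ω × ℝ → ℝ} :
    Integrable F (ν.prod gauss) ↔ Integrable (fun z => F z * phi z.2) (ν.prod volume) := by
  have hdensity :
      ν.prod gauss = (ν.prod volume).withDensity (fun z => gaussianPDF 0 1 z.2) := by
    rw [gauss, gaussianReal_of_var_ne_zero _ one_ne_zero,
      prod_withDensity_right (measurable_gaussianPDF 0 1)]
  rw [hdensity, integrable_withDensity_iff (f := fun z : Ω × ℝ => gaussianPDF 0 1 z.2)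
    ((measurable_gaussianPDF 0 1).comp measurable_snd) (ae_of_all _ fun _ => gaussianPDF_lt_top)]
  simp only [toReal_gaussianPDF]
  rfl

theorem integrable_mul_of_integrable_prod_gauss {Ω : Type*} [MeasurableSpace Ω] {ν : Measure Ω}
    [SFinite ν] {F : Ω × ℝ → ℝ} (hF : Integrable F (ν.prod gauss)) {k : ℝ → ℝ}
    (hk : Continuous k) (hc : HasCompactSupport k) :
    Integrable (fun z : Ω × ℝ => k z.2 * F z) (ν.prod volume) := by
  have hdiv : Continuous fun t => k t * (phi t)⁻¹ :=
    hk.mul (contDiff_phi.continuous.inv₀ fun x => (phi_pos x).ne')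
  obtain ⟨C, hC⟩ := hdiv.bounded_above_of_compact_support hc.mul_right
  refine ((integrable_prod_gauss_iff.1 hF).bdd_mul (c := C)
    (hdiv.measurable.comp measurable_snd).aestronglyMeasurable
    (ae_of_all _ fun z => hC z.2)).congr (ae_of_all _ fun z => ?_)
  simp only [Function.comp]
  field_simp [ne_of_gt (phi_pos z.2)]

namespace HasWeakDeriv

theorem congr {f f' h h' : ℝ → ℝ} (H : HasWeakDeriv f h) (hf : f =ᵐ[volume] f')
    (hh : h =ᵐ[volume] h') : HasWeakDeriv f' h' := by
  refine ⟨H.1.congr hf, H.2.1.congr hh, fun g hg hgc => ?_⟩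
  calc ∫ t, g t * h' t = ∫ t, g t * h t :=
        integral_congr_ae (hh.mono fun t ht => by simp only [ht])
    _ = -∫ t, deriv g t * f t := H.2.2 g hg hgc
    _ = -∫ t, deriv g t * f' t :=
        congrArg Neg.neg (integral_congr_ae (hf.mono fun t ht => by simp only [ht]))

theorem sub {f f' h h' : ℝ → ℝ} (H : HasWeakDeriv f h) (H' : HasWeakDeriv f' h') :
    HasWeakDeriv (fun t => f t - f' t) (fun t => h t - h' t) := by
  refine ⟨H.1.sub H'.1, H.2.1.sub H'.2.1, fun g hg hgc => ?_⟩
  have hg' : Continuous (deriv g) := hg.continuous_deriv (by simp)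
  simp_rw [mul_sub]
  rw [integral_sub (integrable_mul_of_hasCompactSupport H.2.1 hg.continuous hgc)
      (integrable_mul_of_hasCompactSupport H'.2.1 hg.continuous hgc),
    integral_sub (integrable_mul_of_hasCompactSupport H.1 hg' hgc.deriv)
      (integrable_mul_of_hasCompactSupport H'.1 hg' hgc.deriv),
    H.2.2 g hg hgc, H'.2.2 g hg hgc]
  ring

theorem const (c : ℝ) : HasWeakDeriv (fun _ => c) (fun _ => 0) := by
  refine ⟨locallyIntegrable_const _, locallyIntegrable_const _, fun g hg hgc => ?_⟩
  have hderiv : ∫ t, deriv g t = 0 := integral_eq_zero_of_hasDerivAt_of_integrable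
    (fun t => (hg.differentiable (by simp) t).hasDerivAt)
    ((hg.continuous_deriv (by simp)).integrable_of_hasCompactSupport hgc.deriv)
    (hg.continuous.integrable_of_hasCompactSupport hgc)
  simp [integral_mul_const, hderiv]

theorem integral {Ω : Type*} [MeasurableSpace Ω] {ν : Measure Ω} [SFinite ν] {F H : Ω × ℝ → ℝ}
    (hF : Integrable F (ν.prod gauss)) (hH : Integrable H (ν.prod gauss))
    (h : ∀ᵐ s ∂ν, HasWeakDeriv (fun t => F (s, t)) (fun t => H (s, t))) :
    HasWeakDeriv (fun t => ∫ s, F (s, t) ∂ν) (fun t => ∫ s, H (s, t) ∂ν) := by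
  refine ⟨locallyIntegrable_of_integrable_gauss hF.integral_prod_right,
    locallyIntegrable_of_integrable_gauss hH.integral_prod_right, fun g hg hgc => ?_⟩
  have hHg : Integrable (Function.uncurry fun s t => g t * H (s, t)) (ν.prod volume) :=
    integrable_mul_of_integrable_prod_gauss hH hg.continuous hgc
  have hFg : Integrable (Function.uncurry fun s t => deriv g t * F (s, t)) (ν.prod volume) :=
    integrable_mul_of_integrable_prod_gauss hF (hg.continuous_deriv (by simp)) hgc.deriv
  simp_rw [← integral_const_mul]
  rw [← integral_integral_swap hHg, ← integral_integral_swap hFg, ← integral_neg]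
  exact integral_congr_ae (h.mono fun s hs => hs.2.2 g hg hgc)

end HasWeakDeriv

/-! ### Resampling a coordinate -/

section Resample

variable {X Ω Ω' : Type*} [MeasurableSpace X] [MeasurableSpace Ω'] [MeasurableSpace Ω]

/-- The kernel that replaces `z` by `U z s`, where `s` has law `ν`. It is zero unless `U` is
jointly measurable. -/
def resample (U : X → Ω → X) (ν : Measure Ω) : Kernel X X :=
  (Kernel.id ×ₖ Kernel.const X ν).map (Function.uncurry U)

theorem ae_ae_of_measurePreserving_uncurry {U : X → Ω → X} {ν : Measure Ω} [SFinite ν]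
    {μ : Measure X} [SFinite μ] (hU : MeasurePreserving (Function.uncurry U) (μ.prod ν) μ)
    {q : X → Prop} (h : ∀ᵐ z ∂μ, q z) : ∀ᵐ z ∂μ, ∀ᵐ a ∂ν, q (U z a) :=
  Measure.ae_ae_of_ae_prod (hU.quasiMeasurePreserving.ae h)

variable {U : X → Ω → X} (hU : Measurable (Function.uncurry U)) {V : X → Ω' → X}
  (hV : Measurable (Function.uncurry V)) {ν : Measure Ω} {ν' : Measure Ω'} {μ : Measure X}
include hU

theorem resample_apply [SFinite ν] (z : X) : resample U ν z = ν.map (U z) := by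
  rw [resample, Kernel.map_apply _ hU, Kernel.prod_apply, Kernel.id_apply, Kernel.const_apply,
    Measure.dirac_prod, Measure.map_map hU measurable_prodMk_left]
  rfl

theorem isMarkovKernel_resample [IsProbabilityMeasure ν] : IsMarkovKernel (resample U ν) :=
  Kernel.IsMarkovKernel.map _ hU

theorem avg_resample [SFinite ν] {f : X → ℝ} (hf : StronglyMeasurable f) (z : X) :
    avg (resample U ν) f z = ∫ s, f (U z s) ∂ν := by
  rw [avg, resample_apply hU,
    integral_map hU.of_uncurry_left.aemeasurable hf.aestronglyMeasurable]

theorem invariant_resample [SFinite ν] [SFinite μ]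
    (hmp : MeasurePreserving (Function.uncurry U) (μ.prod ν) μ) : (resample U ν).Invariant μ := by
  rw [Kernel.Invariant, resample, ← Measure.map_comp _ _ hU, ← Measure.compProd_eq_comp_prod,
    Measure.compProd_const, hmp.map_eq]

theorem isResampling_resample [IsProbabilityMeasure ν] [SFinite μ]
    (hmp : MeasurePreserving (Function.uncurry U) (μ.prod ν) μ)
    (hUU : ∀ z s t, U (U z s) t = U z t) : IsResampling (resample U ν) μ where
  invariant := invariant_resample hU hmp
  ae_avg_eq f hf z := by
    have := isMarkovKernel_resample hU (ν := ν)
    rw [resample_apply hU, ae_map_iff hU.of_uncurry_left.aemeasurable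
      (measurableSet_eq_fun (stronglyMeasurable_avg hf).measurable measurable_const)]
    exact ae_of_all _ fun s => by simp only [avg_resample hU hf, hUU]

include hV

variable [SFinite ν] [SFinite ν']

theorem resample_comp_apply (z : X) :
    (resample V ν' ∘ₖ resample U ν) z = (ν.prod ν').map fun s => V (U z s.1) s.2 := by
  have hVU : Measurable fun s : Ω × Ω' => V (U z s.1) s.2 :=
    hV.comp ((hU.of_uncurry_left.comp measurable_fst).prodMk measurable_snd)
  ext A hA
  rw [Kernel.comp_apply' _ _ _ hA, resample_apply hU,
    lintegral_map (Kernel.measurable_coe _ hA) hU.of_uncurry_left, Measure.map_apply hVU hA,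
    Measure.prod_apply (hVU hA)]
  refine lintegral_congr fun s => ?_
  rw [resample_apply hV, Measure.map_apply hV.of_uncurry_left hA]
  rfl

theorem resample_comp_comm (hUV : ∀ z s t, V (U z s) t = U (V z t) s) :
    resample V ν' ∘ₖ resample U ν = resample U ν ∘ₖ resample V ν' := by
  ext1 z
  have hUV_meas : Measurable fun s : Ω' × Ω => U (V z s.1) s.2 :=
    hU.comp ((hV.of_uncurry_left.comp measurable_fst).prodMk measurable_snd)
  rw [resample_comp_apply hU hV, resample_comp_apply hV hU, ← Measure.prod_swap (μ := ν),
    Measure.map_map hUV_meas measurable_swap]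
  simp only [hUV]
  rfl

end Resample

/-! ### Mean square convergence of iterated averages -/

section MeanConv

variable {X : Type*} [MeasurableSpace X] {μ : Measure X} {K : ℕ → Kernel X X}

theorem MeanConv.const_mul {u : X → ℝ} (hu : MeanConv K μ u) (c : ℝ) :
    MeanConv K μ fun z => c * u z := by
  have hlim := Tendsto.const_mul (c ^ 2) hu
  rw [mul_zero] at hlim
  exact hlim.congr fun n => by rw [avgIter_const_mul, variance_const_mul]

theorem eLpNorm_two_eq_ofReal_sqrt_integral_sq {u : X → ℝ} (hu : MemLp u 2 μ) :
    eLpNorm u 2 μ = ENNReal.ofReal √(∫ z, u z ^ 2 ∂μ) := by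
  rw [hu.eLpNorm_eq_integral_rpow_norm (by simp) (by simp)]
  simp [Real.sqrt_eq_rpow]

theorem variance_add_le_two_mul_add [IsProbabilityMeasure μ] {u v : X → ℝ} (hu : MemLp u 2 μ)
    (hv : MemLp v 2 μ) : Var[fun z => u z + v z; μ] ≤ 2 * Var[u; μ] + 2 * Var[v; μ] := by
  have hadd : Var[fun z => u z + v z; μ] = _ := variance_add hu hv
  have hsub := variance_sub hu hv
  linarith [variance_nonneg (u - v) μ]

variable [IsProbabilityMeasure μ] [∀ n, IsMarkovKernel (K n)] (hK : ∀ n, (K n).Invariant μ)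
include hK

theorem variance_avgIter_add_le {u v : X → ℝ} (hu : MemLp u 2 μ) (hv : MemLp v 2 μ) (n : ℕ) :
    Var[avgIter K n fun z => u z + v z; μ]
      ≤ 2 * Var[avgIter K n u; μ] + 2 * Var[avgIter K n v; μ] := by
  rw [variance_congr (avgIter_add_ae hK (hu.integrable one_le_two) (hv.integrable one_le_two) n)]
  exact variance_add_le_two_mul_add (memLp_two_avgIter hK hu n) (memLp_two_avgIter hK hv n)

theorem MeanConv.add {u v : X → ℝ} (hu : MemLp u 2 μ) (hv : MemLp v 2 μ)
    (hu_conv : MeanConv K μ u) (hv_conv : MeanConv K μ v) :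
    MeanConv K μ fun z => u z + v z := by
  have hlim := (Tendsto.const_mul 2 hu_conv).add (Tendsto.const_mul 2 hv_conv)
  simp only [mul_zero, add_zero] at hlim
  exact squeeze_zero (fun n => variance_nonneg _ _) (variance_avgIter_add_le hK hu hv) hlim

theorem MeanConv.of_variance_approx {u : X → ℝ} (hu : MemLp u 2 μ)
    (h : ∀ ε > 0, ∃ v, Var[u - v; μ] ≤ ε ∧ MemLp v 2 μ ∧ MeanConv K μ v) :
    MeanConv K μ u := by
  refine tendsto_order.2 ⟨fun a ha => .of_forall fun n => ha.trans_le (variance_nonneg _ _),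
    fun ε hε => ?_⟩
  obtain ⟨v, huv, hv, hv_conv⟩ := h (ε / 4) (by positivity)
  filter_upwards [hv_conv.eventually_lt_const (show 0 < ε / 4 by positivity)] with n hn
  have hsplit := variance_avgIter_add_le hK hv (hu.sub hv) n
  simp only [Pi.sub_apply, add_sub_cancel] at hsplit
  linarith [variance_avgIter_le hK (hu.sub hv) n]

theorem MeanConv.of_measureDense {𝒜 : Set (Set X)} (h𝒜 : μ.MeasureDense 𝒜)
    (h : ∀ A ∈ 𝒜, MeanConv K μ (A.indicator 1)) {u : X → ℝ} (hu : MemLp u 2 μ) :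
    MeanConv K μ u := by
  refine MeanConv.of_variance_approx hK hu fun ε hε => ?_
  have hindicator (c : ℝ) ⦃A : Set X⦄ (hA : MeasurableSet A) (hμA : μ A < ⊤) ⦃δ : ℝ≥0∞⦄
      (hδ : δ ≠ 0) : ∃ v : X → ℝ, eLpNorm (v - A.indicator fun _ => c) 2 μ ≤ δ ∧
        MemLp v 2 μ ∧ MeanConv K μ v := by
    obtain ⟨η, hη, hη_le⟩ := exists_eLpNorm_indicator_le (p := 2) (μ := μ) (by simp) c hδ
    obtain ⟨B, hB, hAB⟩ := h𝒜.approx A hA hμA.ne η hη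
    refine ⟨B.indicator fun _ => c, ?_, (memLp_const c).indicator (h𝒜.measurable B hB), ?_⟩
    · rw [eLpNorm_indicator_sub_indicator]
      exact hη_le _ (by rw [symmDiff_comm]; simpa using hAB.le)
    · have hsmul : (B.indicator fun _ => c) = fun z => c * B.indicator 1 z := by
        ext z
        by_cases hz : z ∈ B <;> simp [hz]
      exact hsmul ▸ (h B hB).const_mul c
  obtain ⟨v, huv, hv, hv_conv⟩ := hu.induction_dense (by simp)
    (fun v => MemLp v 2 μ ∧ MeanConv K μ v) hindicator
    (fun _ _ hv hw => ⟨hv.1.add hw.1, MeanConv.add hK hv.1 hw.1 hv.2 hw.2⟩)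
    (fun _ hv => hv.1.1) (ε := ENNReal.ofReal √ε) (by simpa using hε)
  refine ⟨v, ?_, hv, hv_conv⟩
  rw [eLpNorm_two_eq_ofReal_sqrt_integral_sq (hu.sub hv),
    ENNReal.ofReal_le_ofReal_iff (Real.sqrt_nonneg _), Real.sqrt_le_sqrt_iff hε.le] at huv
  exact (variance_le_expectation_sq (hu.sub hv).1).trans huv

end MeanConv

/-! ### Resampling one coordinate of the product space -/

theorem measurePreserving_update {ι : Type*} [DecidableEq ι] {Y : ι → Type*}
    [∀ i, MeasurableSpace (Y i)] (ν : ∀ i, Measure (Y i)) [∀ i, IsProbabilityMeasure (ν i)]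
    (i : ι) :
    MeasurePreserving (fun x : (∀ j, Y j) × Y i => Function.update x.1 i x.2)
      ((Measure.infinitePi ν).prod (ν i)) (Measure.infinitePi ν) := by
  have hmeas : Measurable fun x : (∀ j, Y j) × Y i => Function.update x.1 i x.2 :=
    measurable_update'
  refine ⟨hmeas, Measure.eq_infinitePi _ fun s t ht => ?_⟩
  have hpreimage : (fun x : (∀ j, Y j) × Y i => Function.update x.1 i x.2) ⁻¹' Set.pi s t
      = Set.pi (s.erase i) t ×ˢ (if i ∈ s then t i else Set.univ) := by
    ext ⟨x, y⟩
    simp only [Set.mem_preimage, Set.mem_pi, Set.mem_prod, Finset.mem_coe, Finset.mem_erase]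
    constructor
    · refine fun h => ⟨fun j hj => by simpa [Function.update_of_ne hj.1] using h j hj.2, ?_⟩
      split_ifs with hi
      · simpa using h i hi
      · trivial
    · rintro ⟨hx, hy⟩ j hj
      obtain rfl | hji := eq_or_ne j i
      · simpa [hj] using hy
      · simpa [Function.update_of_ne hji] using hx j ⟨hji, hj⟩
  rw [Measure.map_apply hmeas (.pi s.countable_toSet fun j _ => ht j), hpreimage,
    Measure.prod_prod, Measure.infinitePi_pi _ fun j _ => ht j]
  split_ifs with hi
  · rw [Finset.prod_erase_mul s _ hi]
  · rw [measure_univ, mul_one, Finset.erase_eq_of_notMem hi]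

section CoordKernel

variable {S : Type*} {p : I}

instance : IsProbabilityMeasure (ber p) := by unfold ber; infer_instance

instance : IsProbabilityMeasure (mu S p) := by unfold mu; infer_instance

open Classical in
/-- Replace the Bernoulli coordinate `s` by `b`. -/
def updateBer (s : S) (z : Space S) (b : Bool) : Space S := (Function.update z.1 s b, z.2)

/-- Replace the Gaussian coordinate `i` by `t`. -/
def updateGauss (i : ℕ) (z : Space S) (t : ℝ) : Space S := (z.1, Function.update z.2 i t)

theorem measurable_updateBer (s : S) : Measurable (Function.uncurry (updateBer s)) := by
  classical
  exact (measurable_update'.comp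
    ((measurable_fst.comp measurable_fst).prodMk measurable_snd)).prodMk
      (measurable_snd.comp measurable_fst)

theorem measurable_updateGauss (i : ℕ) :
    Measurable (Function.uncurry (updateGauss (S := S) i)) :=
  (measurable_fst.comp measurable_fst).prodMk (measurable_update'.comp
    ((measurable_snd.comp measurable_fst).prodMk measurable_snd))

theorem measurePreserving_updateGauss (i : ℕ) :
    MeasurePreserving (Function.uncurry (updateGauss i)) ((mu S p).prod gauss) (mu S p) :=
  ((MeasurePreserving.id _).prod (measurePreserving_update (fun _ => gauss) i)).comp
    (measurePreserving_prodAssoc _ _ gauss)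

theorem measurePreserving_updateBer (s : S) :
    MeasurePreserving (Function.uncurry (updateBer s)) ((mu S p).prod (ber p)) (mu S p) := by
  classical
  have hupdate := (measurePreserving_update (fun _ : S => ber p) s).prod
    (MeasurePreserving.id (Measure.infinitePi fun _ : ℕ => gauss))
  have hswap := (MeasurePreserving.id (Measure.infinitePi fun _ : S => ber p)).prod
    (Measure.measurePreserving_swap (μ := Measure.infinitePi fun _ : ℕ => gauss) (ν := ber p))
  convert! hupdate.comp ((measurePreserving_prodAssoc _ _ _).symm.comp
    (hswap.comp (measurePreserving_prodAssoc _ _ _))) using 1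

/-- The kernel that resamples one coordinate. -/
def coordKernel (p : I) : S ⊕ ℕ → Kernel (Space S) (Space S)
  | .inl s => resample (updateBer s) (ber p)
  | .inr i => resample (updateGauss i) gauss

instance : ∀ j : S ⊕ ℕ, IsMarkovKernel (coordKernel p j)
  | .inl s => isMarkovKernel_resample (measurable_updateBer s)
  | .inr i => isMarkovKernel_resample (measurable_updateGauss i)

theorem isResampling_coordKernel : ∀ j : S ⊕ ℕ, IsResampling (coordKernel p j) (mu S p)
  | .inl s => isResampling_resample (measurable_updateBer s) (measurePreserving_updateBer s)
      fun z a b => by simp [updateBer]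
  | .inr i => isResampling_resample (measurable_updateGauss i) (measurePreserving_updateGauss i)
      fun z a b => by simp [updateGauss]

theorem coordKernel_comm (j k : S ⊕ ℕ) :
    coordKernel p j ∘ₖ coordKernel p k = coordKernel p k ∘ₖ coordKernel p j := by
  classical
  obtain rfl | hjk := eq_or_ne j k
  · rfl
  rcases j with s | i <;> rcases k with s' | i'
  · refine resample_comp_comm (measurable_updateBer s') (measurable_updateBer s) fun z a b => ?_
    simp only [updateBer]
    rw [Function.update_comm fun h => hjk (by rw [h])]
  · exact resample_comp_comm (measurable_updateGauss i') (measurable_updateBer s) fun _ _ _ => rfl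
  · exact resample_comp_comm (measurable_updateBer s') (measurable_updateGauss i) fun _ _ _ => rfl
  · refine resample_comp_comm (measurable_updateGauss i') (measurable_updateGauss i)
      fun z a b => ?_
    simp only [updateGauss]
    rw [Function.update_comm fun h => hjk (by rw [h])]

theorem avg_coordKernel_inl {f : Space S → ℝ} (hf : StronglyMeasurable f) (s : S) (z : Space S) :
    avg (coordKernel p (.inl s)) f z = ∫ b, f (updateBer s z b) ∂(ber p) :=
  avg_resample (measurable_updateBer s) hf z

theorem avg_coordKernel_inr {f : Space S → ℝ} (hf : StronglyMeasurable f) (i : ℕ) (z : Space S) :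
    avg (coordKernel p (.inr i)) f z = ∫ t, f (updateGauss i z t) ∂gauss :=
  avg_resample (measurable_updateGauss i) hf z

/-- The points `z` and `z'` have the same coordinates in `J`. -/
def AgreeOn (J : Set (S ⊕ ℕ)) (z z' : Space S) : Prop :=
  (∀ s, .inl s ∈ J → z.1 s = z'.1 s) ∧ ∀ i, .inr i ∈ J → z.2 i = z'.2 i

theorem AgreeOn.mono {J J' : Set (S ⊕ ℕ)} {z z' : Space S} (h : AgreeOn J z z') (hJ : J' ⊆ J) :
    AgreeOn J' z z' :=
  ⟨fun s hs => h.1 s (hJ hs), fun i hi => h.2 i (hJ hi)⟩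

theorem AgreeOn.updateBer {J : Set (S ⊕ ℕ)} {s : S} {z z' : Space S}
    (h : AgreeOn (J \ {.inl s}) z z') (b : Bool) :
    AgreeOn J (updateBer s z b) (updateBer s z' b) := by
  refine ⟨fun s' hs' => ?_, fun i hi => h.2 i ⟨hi, by simp⟩⟩
  obtain rfl | hne := eq_or_ne s' s
  · simp [BernoulliGauss.updateBer]
  · simpa [BernoulliGauss.updateBer, hne] using h.1 s' ⟨hs', by simpa using hne⟩

theorem AgreeOn.updateGauss {J : Set (S ⊕ ℕ)} {i : ℕ} {z z' : Space S}
    (h : AgreeOn (J \ {.inr i}) z z') (t : ℝ) :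
    AgreeOn J (updateGauss i z t) (updateGauss i z' t) := by
  refine ⟨fun s hs => h.1 s ⟨hs, by simp⟩, fun i' hi' => ?_⟩
  obtain rfl | hne := eq_or_ne i' i
  · simp [BernoulliGauss.updateGauss]
  · simpa [BernoulliGauss.updateGauss, hne] using h.2 i' ⟨hi', by simpa using hne⟩

/-- The value `f z` is determined by the coordinates of `z` in `J`. -/
def DependsOnCoords (f : Space S → ℝ) (J : Set (S ⊕ ℕ)) : Prop :=
  ∀ z z', AgreeOn J z z' → f z = f z'

theorem DependsOnCoords.avg_coordKernel {f : Space S → ℝ} {J : Set (S ⊕ ℕ)}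
    (h : DependsOnCoords f J) (hf : StronglyMeasurable f) (j : S ⊕ ℕ) :
    DependsOnCoords (avg (coordKernel p j) f) (J \ {j}) := by
  intro z z' hz
  rcases j with s | i
  · rw [avg_coordKernel_inl hf, avg_coordKernel_inl hf]
    congr with b
    exact h _ _ (hz.updateBer b)
  · rw [avg_coordKernel_inr hf, avg_coordKernel_inr hf]
    congr with t
    exact h _ _ (hz.updateGauss t)

theorem DependsOnCoords.avgIter_coordKernel {f : Space S → ℝ} {J : Set (S ⊕ ℕ)}
    (h : DependsOnCoords f J) (hf : StronglyMeasurable f) (e : ℕ → S ⊕ ℕ) (n : ℕ) :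
    DependsOnCoords (avgIter (fun n => coordKernel p (e n)) n f) (J \ e '' Set.Iio n) := by
  induction n with
  | zero => simpa [avgIter] using h
  | succ n ih =>
    refine fun z z' hz => ih.avg_coordKernel (stronglyMeasurable_avgIter hf n) (e n) z z'
      (hz.mono ?_)
    rintro j ⟨⟨hjJ, hj⟩, hjn⟩
    refine ⟨hjJ, ?_⟩
    rintro ⟨m, hm, rfl⟩
    obtain hm | rfl := (Nat.lt_succ_iff.1 hm).lt_or_eq
    exacts [hj ⟨m, hm, rfl⟩, hjn rfl]

theorem variance_eq_zero_of_forall_eq {X : Type*} [MeasurableSpace X] {μ : Measure X}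
    [IsProbabilityMeasure μ] {f : X → ℝ} (h : ∀ z z', f z = f z') : Var[f; μ] = 0 := by
  obtain ⟨z⟩ := nonempty_of_isProbabilityMeasure μ
  have hconst : f = fun _ => f z := funext fun w => h w z
  rw [hconst, variance_eq_integral aemeasurable_const]
  simp

theorem DependsOnCoords.meanConv {f : Space S → ℝ} {J : Set (S ⊕ ℕ)} (h : DependsOnCoords f J)
    (hJ : J.Finite) (hf : StronglyMeasurable f) {e : ℕ → S ⊕ ℕ} (he : Function.Surjective e) :
    MeanConv (fun n => coordKernel p (e n)) (mu S p) f := by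
  choose rank hrank using he
  obtain ⟨N, hN⟩ := (hJ.image rank).bddAbove
  refine tendsto_const_nhds.congr' ?_
  filter_upwards [eventually_gt_atTop N] with n hn
  have hempty : J \ e '' Set.Iio n = ∅ := by
    rw [Set.sdiff_eq_empty]
    exact fun j hj => ⟨rank j, (hN ⟨j, hj, rfl⟩).trans_lt hn, hrank j⟩
  have hdep := h.avgIter_coordKernel (p := p) hf e n
  rw [hempty] at hdep
  exact (variance_eq_zero_of_forall_eq fun z z' =>
    hdep z z' ⟨fun _ => False.elim, fun _ => False.elim⟩).symm

/-- The measurable sets that are determined by finitely many coordinates. -/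
def finiteCylinders (S : Type*) : Set (Set (Space S)) :=
  {A | MeasurableSet A ∧ ∃ J : Set (S ⊕ ℕ), J.Finite ∧ ∀ z z', AgreeOn J z z' → (z ∈ A ↔ z' ∈ A)}

theorem isSetAlgebra_finiteCylinders : IsSetAlgebra (finiteCylinders S) where
  empty_mem := ⟨.empty, ∅, Set.finite_empty, fun _ _ _ => Iff.rfl⟩
  compl_mem := fun _ ⟨hA, J, hJ, h⟩ => ⟨hA.compl, J, hJ, fun z z' hz => not_congr (h z z' hz)⟩
  union_mem := fun _ _ ⟨hA, J, hJ, h⟩ ⟨hB, J', hJ', h'⟩ =>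
    ⟨hA.union hB, J ∪ J', hJ.union hJ', fun z z' hz =>
      or_congr (h z z' (hz.mono Set.subset_union_left)) (h' z z' (hz.mono Set.subset_union_right))⟩

theorem generateFrom_finiteCylinders :
    MeasurableSpace.generateFrom (finiteCylinders S)
      = (inferInstance : MeasurableSpace (Space S)) := by
  refine le_antisymm (MeasurableSpace.generateFrom_le fun A hA => hA.1) ?_
  have hber (s : S) :
      Measurable[MeasurableSpace.generateFrom (finiteCylinders S)] fun z => z.1 s :=
    fun B hB => MeasurableSpace.measurableSet_generateFrom
      ⟨((measurable_pi_apply s).comp measurable_fst) hB, {.inl s}, Set.finite_singleton _,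
        fun z z' hz => by simp [hz.1 s rfl]⟩
  have hgauss (i : ℕ) :
      Measurable[MeasurableSpace.generateFrom (finiteCylinders S)] fun z => z.2 i :=
    fun B hB => MeasurableSpace.measurableSet_generateFrom
      ⟨((measurable_pi_apply i).comp measurable_snd) hB, {.inr i}, Set.finite_singleton _,
        fun z z' hz => by simp [hz.2 i rfl]⟩
  exact sup_le (@measurable_pi_lambda _ _ _ (_) _ _ hber).comap_le
    (@measurable_pi_lambda _ _ _ (_) _ _ hgauss).comap_le

theorem isResamplingFamily_coordKernel {e : ℕ → S ⊕ ℕ} (he : Function.Surjective e) :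
    IsResamplingFamily (fun n => coordKernel p (e n)) (mu S p) where
  isResampling _ := isResampling_coordKernel _
  comm _ _ := coordKernel_comm _ _
  meanConv u hu := by
    refine MeanConv.of_measureDense (fun n => (isResampling_coordKernel (e n)).invariant)
      (Measure.MeasureDense.of_generateFrom_isSetAlgebra_finite _ isSetAlgebra_finiteCylinders
        generateFrom_finiteCylinders.symm) ?_ hu
    rintro A ⟨hA, J, hJ, h⟩
    refine DependsOnCoords.meanConv (J := J) (fun z z' hz => ?_) hJ
      (stronglyMeasurable_one.indicator hA) he
    by_cases hz' : z' ∈ A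
    · simp [hz', (h z z' hz).2 hz']
    · simp [hz', mt (h z z' hz).1 hz']

end CoordKernel

/-! ### Coordinate gradients -/

section Fluctuation

variable {X : Type*} [MeasurableSpace X] {μ : Measure X} {κ η : Kernel X X} {g g' G G' : X → ℝ}

/-- `G` is the difference of the square integrable function `g` and its average under `κ`; it plays
the role of a discrete gradient of `g`. -/
structure IsFluctuation (κ : Kernel X X) (μ : Measure X) (g G : X → ℝ) : Prop where
  stronglyMeasurable : StronglyMeasurable g
  memLp : MemLp g 2 μ
  ae_eq : G =ᵐ[μ] fun z => g z - avg κ g z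

namespace IsFluctuation

theorem avg_sq_ae (hκ : IsResampling κ μ) (h : IsFluctuation κ μ g G) :
    ∀ᵐ z ∂μ, avg κ (fun w => G w ^ 2) z = Var[g; κ z] := by
  filter_upwards [ae_ae_of_invariant hκ.invariant h.ae_eq] with z hz
  rw [variance_eq_integral h.stronglyMeasurable.measurable.aemeasurable]
  refine integral_congr_ae ?_
  filter_upwards [hz, hκ.ae_avg_eq g h.stronglyMeasurable z] with w hw havg
  rw [hw, havg, avg]

variable [IsProbabilityMeasure μ]

theorem memLp_grad [IsMarkovKernel κ] (hκ : κ.Invariant μ) (h : IsFluctuation κ μ g G) :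
    MemLp G 2 μ :=
  (h.memLp.sub (memLp_two_avg hκ h.memLp)).ae_eq h.ae_eq.symm

theorem sub (hκ : κ.Invariant μ) (h : IsFluctuation κ μ g G) (h' : IsFluctuation κ μ g' G') :
    IsFluctuation κ μ (fun z => g z - g' z) (fun z => G z - G' z) where
  stronglyMeasurable := h.stronglyMeasurable.sub h'.stronglyMeasurable
  memLp := h.memLp.sub h'.memLp
  ae_eq := by
    filter_upwards [h.ae_eq, h'.ae_eq, avg_sub_ae hκ (h.memLp.integrable one_le_two)
      (h'.memLp.integrable one_le_two)] with z hG hG' havg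
    rw [hG, hG', havg]
    ring

theorem avg_of_comm [IsMarkovKernel η] (hκ : κ.Invariant μ) (hη : η.Invariant μ)
    (hcomm : κ ∘ₖ η = η ∘ₖ κ) (h : IsFluctuation κ μ g G) :
    IsFluctuation κ μ (avg η g) (avg η G) where
  stronglyMeasurable := stronglyMeasurable_avg h.stronglyMeasurable
  memLp := memLp_two_avg hη h.memLp
  ae_eq := by
    have hint := h.memLp.integrable one_le_two
    filter_upwards [avg_congr_ae hη h.ae_eq, avg_sub_ae hη hint (integrable_avg hκ hint),
      avg_comm_ae hκ hη hcomm hint] with z hG hsub hcomm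
    rw [hG, hsub, hcomm]

theorem avg_self [IsMarkovKernel κ] (hκ : IsResampling κ μ) (h : IsFluctuation κ μ g G) :
    IsFluctuation κ μ (avg κ g) (fun _ => 0) where
  stronglyMeasurable := stronglyMeasurable_avg h.stronglyMeasurable
  memLp := memLp_two_avg hκ.invariant h.memLp
  ae_eq := ae_of_all _ fun z => by simp only [hκ.avg_avg h.stronglyMeasurable, sub_self]

end IsFluctuation

end Fluctuation

section CoordGrad

variable {S : Type*} {p : I}

theorem IsPartialDeriv.avg_resample {Ω : Type*} [MeasurableSpace Ω] {ν : Measure Ω}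
    [IsProbabilityMeasure ν] {U : Space S → Ω → Space S} (hU : Measurable (Function.uncurry U))
    (hmp : MeasurePreserving (Function.uncurry U) ((mu S p).prod ν) (mu S p)) {i : ℕ}
    (hcomm : ∀ z a t, updateGauss i (U z a) t = U (updateGauss i z t) a) {g G : Space S → ℝ}
    (hg : StronglyMeasurable g) (hg_int : Integrable g (mu S p)) (hG : StronglyMeasurable G)
    (h : IsPartialDeriv p i g G) :
    IsPartialDeriv p i (avg (resample U ν) g) (avg (resample U ν) G) := by
  have := isMarkovKernel_resample hU (ν := ν)
  refine ⟨memLp_two_avg (invariant_resample hU hmp) h.1, ?_⟩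
  have havg {u : Space S → ℝ} (hu : StronglyMeasurable u) (z : Space S) :
      (fun t => avg (resample U ν) u (updateGauss i z t))
        = fun t => ∫ a, u (updateGauss i (U z a) t) ∂ν := by
    simp only [hcomm, BernoulliGauss.avg_resample hU hu]
  have hupdate := ((measurePreserving_updateGauss (p := p) i).comp
    (hmp.prod (MeasurePreserving.id gauss))).comp
      (measurePreserving_prodAssoc (mu S p) ν gauss).symm
  have hint {u : Space S → ℝ} (hu : Integrable u (mu S p)) : ∀ᵐ z ∂(mu S p),
      Integrable (fun x : Ω × ℝ => u (updateGauss i (U z x.1) x.2)) (ν.prod gauss) :=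
    (hupdate.integrable_comp_of_integrable hu).prod_right_ae
  filter_upwards [ae_ae_of_measurePreserving_uncurry hmp h.2, hint hg_int,
    hint (h.1.integrable one_le_two)] with z hline hgz hGz
  change HasWeakDeriv (fun t => avg (resample U ν) g (updateGauss i z t))
    (fun t => avg (resample U ν) G (updateGauss i z t))
  rw [havg hg, havg hG]
  exact .integral hgz hGz hline

/-- `G` is a partial derivative of `g` with respect to the Gaussian coordinate `i`, both functions
being square integrable and everywhere defined representatives. -/
structure IsGaussGrad (p : I) (i : ℕ) (g G : Space S → ℝ) : Prop where
  stronglyMeasurable : StronglyMeasurable g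
  memLp : MemLp g 2 (mu S p)
  stronglyMeasurable_grad : StronglyMeasurable G
  isPartialDeriv : IsPartialDeriv p i g G

namespace IsGaussGrad

variable {i : ℕ} {g g' G G' : Space S → ℝ}

theorem sub (h : IsGaussGrad p i g G) (h' : IsGaussGrad p i g' G') :
    IsGaussGrad p i (fun z => g z - g' z) (fun z => G z - G' z) where
  stronglyMeasurable := h.stronglyMeasurable.sub h'.stronglyMeasurable
  memLp := h.memLp.sub h'.memLp
  stronglyMeasurable_grad := h.stronglyMeasurable_grad.sub h'.stronglyMeasurable_grad
  isPartialDeriv := ⟨h.isPartialDeriv.1.sub h'.isPartialDeriv.1, by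
    filter_upwards [h.isPartialDeriv.2, h'.isPartialDeriv.2] with z hz hz' using hz.sub hz'⟩

theorem avg_of_ne {k : S ⊕ ℕ} (hk : k ≠ .inr i) (h : IsGaussGrad p i g G) :
    IsGaussGrad p i (avg (coordKernel p k) g) (avg (coordKernel p k) G) where
  stronglyMeasurable := stronglyMeasurable_avg h.stronglyMeasurable
  memLp := memLp_two_avg (isResampling_coordKernel k).invariant h.memLp
  stronglyMeasurable_grad := stronglyMeasurable_avg h.stronglyMeasurable_grad
  isPartialDeriv := by
    have hint := h.memLp.integrable one_le_two
    rcases k with s | k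
    · exact h.isPartialDeriv.avg_resample (measurable_updateBer s) (measurePreserving_updateBer s)
        (fun _ _ _ => rfl) h.stronglyMeasurable hint h.stronglyMeasurable_grad
    · refine h.isPartialDeriv.avg_resample (measurable_updateGauss k)
        (measurePreserving_updateGauss k) (fun z a t => ?_) h.stronglyMeasurable hint
        h.stronglyMeasurable_grad
      simp only [updateGauss]
      rw [Function.update_comm fun hki => hk (by rw [hki])]

theorem avg_self (h : IsGaussGrad p i g G) :
    IsGaussGrad p i (avg (coordKernel p (.inr i)) g) (fun _ => 0) where
  stronglyMeasurable := stronglyMeasurable_avg h.stronglyMeasurable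
  memLp := memLp_two_avg (isResampling_coordKernel _).invariant h.memLp
  stronglyMeasurable_grad := stronglyMeasurable_const
  isPartialDeriv := by
    refine ⟨MemLp.zero, ae_of_all _ fun z => ?_⟩
    have hconst (t : ℝ) : avg (coordKernel p (.inr i)) g (z.1, Function.update z.2 i t)
        = avg (coordKernel p (.inr i)) g z := by
      simp [avg_coordKernel_inr h.stronglyMeasurable, updateGauss]
    simp only [hconst]
    exact HasWeakDeriv.const _

theorem entBound (h : IsGaussGrad p i g G) :
    ∀ᵐ z ∂(mu S p), EntBound (coordKernel p (.inr i) z) g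
      (2 * avg (coordKernel p (.inr i)) (fun w => G w ^ 2) z) := by
  have hinv := (isResampling_coordKernel (S := S) (p := p) (.inr i)).invariant
  filter_upwards [ae_memLp_two_of_invariant hinv h.memLp,
    ae_memLp_two_of_invariant hinv h.isPartialDeriv.1, h.isPartialDeriv.2] with z hg hG hderiv
  have hU : Measurable (updateGauss i z) := (measurable_updateGauss i).of_uncurry_left
  have hmap : coordKernel p (.inr i) z = gauss.map (updateGauss i z) :=
    resample_apply (measurable_updateGauss i) z
  have havg : avg (coordKernel p (.inr i)) (fun w => G w ^ 2) z
      = ∫ t, G (updateGauss i z t) ^ 2 ∂gauss :=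
    avg_coordKernel_inr (h.stronglyMeasurable_grad.pow 2) i z
  rw [hmap] at hg hG ⊢
  rw [havg]
  exact EntBound.map hU h.stronglyMeasurable.measurable
    (entBound_gauss (hg.comp_of_map hU.aemeasurable) (hG.comp_of_map hU.aemeasurable) hderiv)

end IsGaussGrad

theorem IsFluctuation.entBound (hp0 : 0 < p) (hp1 : p < 1) {s : S} {g G : Space S → ℝ}
    (h : IsFluctuation (coordKernel p (.inl s)) (mu S p) g G) :
    ∀ᵐ z ∂(mu S p), EntBound (coordKernel p (.inl s) z) g
      (cLS p * avg (coordKernel p (.inl s)) (fun w => G w ^ 2) z) := by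
  filter_upwards [h.avg_sq_ae (isResampling_coordKernel _)] with z hz
  have hU : Measurable (updateBer s z) := (measurable_updateBer s).of_uncurry_left
  have hg := h.stronglyMeasurable.measurable
  have hmap : coordKernel p (.inl s) z = (ber p).map (updateBer s z) :=
    resample_apply (measurable_updateBer s) z
  rw [hz, hmap, variance_map hg.aemeasurable hU.aemeasurable]
  exact EntBound.map hU hg (entBound_ber hp0 hp1 _)

/-- The logarithmic Sobolev constant of one coordinate. -/
def coordConst (p : I) : S ⊕ ℕ → ℝ
  | .inl _ => cLS p
  | .inr _ => 2

/-- `G` is the partial gradient of `g` with respect to one coordinate: the fluctuation `Δ_s g` for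
a Bernoulli coordinate `s`, the partial derivative for a Gaussian coordinate. -/
def CoordGrad (p : I) : S ⊕ ℕ → (Space S → ℝ) → (Space S → ℝ) → Prop
  | .inl s => IsFluctuation (coordKernel p (.inl s)) (mu S p)
  | .inr i => IsGaussGrad p i

namespace CoordGrad

variable {g g' G G' : Space S → ℝ}

theorem memLp : ∀ {j : S ⊕ ℕ}, CoordGrad p j g G → MemLp g 2 (mu S p)
  | .inl _, h => IsFluctuation.memLp h
  | .inr _, h => IsGaussGrad.memLp h

theorem memLp_grad : ∀ {j : S ⊕ ℕ}, CoordGrad p j g G → MemLp G 2 (mu S p)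
  | .inl _, h => IsFluctuation.memLp_grad (isResampling_coordKernel _).invariant h
  | .inr _, h => h.isPartialDeriv.1

theorem sub : ∀ {j : S ⊕ ℕ}, CoordGrad p j g G → CoordGrad p j g' G' →
    CoordGrad p j (fun z => g z - g' z) (fun z => G z - G' z)
  | .inl _, h, h' => IsFluctuation.sub (isResampling_coordKernel _).invariant h h'
  | .inr _, h, h' => IsGaussGrad.sub h h'

theorem avg_of_ne {k : S ⊕ ℕ} : ∀ {j : S ⊕ ℕ}, k ≠ j → CoordGrad p j g G →
    CoordGrad p j (avg (coordKernel p k) g) (avg (coordKernel p k) G)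
  | .inl _, _, h => IsFluctuation.avg_of_comm (isResampling_coordKernel _).invariant
      (isResampling_coordKernel k).invariant (coordKernel_comm _ _) h
  | .inr _, hk, h => IsGaussGrad.avg_of_ne hk h

theorem avg_self : ∀ {j : S ⊕ ℕ}, CoordGrad p j g G →
    CoordGrad p j (avg (coordKernel p j) g) (fun _ => 0)
  | .inl _, h => IsFluctuation.avg_self (isResampling_coordKernel _) h
  | .inr _, h => IsGaussGrad.avg_self h

theorem entBound (hp0 : 0 < p) (hp1 : p < 1) : ∀ {j : S ⊕ ℕ}, CoordGrad p j g G →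
    ∀ᵐ z ∂(mu S p), EntBound (coordKernel p j z) g
      (coordConst p j * avg (coordKernel p j) (fun w => G w ^ 2) z)
  | .inl _, h => IsFluctuation.entBound hp0 hp1 h
  | .inr _, h => IsGaussGrad.entBound h

end CoordGrad

theorem isLogSobolev_coordGrad (hp0 : 0 < p) (hp1 : p < 1) {e : ℕ → S ⊕ ℕ}
    (he : Function.Injective e) :
    IsLogSobolev (fun n => coordKernel p (e n)) (mu S p) (fun n => coordConst p (e n))
      (fun n => CoordGrad p (e n)) where
  memLp h := h.memLp
  memLp_grad h := h.memLp_grad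
  sub h h' := h.sub h'
  avg_of_ne hmn h := h.avg_of_ne (he.ne hmn)
  avg_self h := h.avg_self
  entBound h := h.entBound hp0 hp1

end CoordGrad

/-! ### Optimizing the parameter -/

theorem pos_and_mul_log_div_le_of_forall {V A B : ℝ} (hV : 0 < V) (hB : 0 ≤ B)
    (h : ∀ t, 0 < t → V * (1 + Real.log t) ≤ A + t * B) :
    0 < B ∧ V * Real.log (V / B) ≤ A := by
  have hB_pos : 0 < B := by
    refine hB.lt_of_ne fun hB0 => ?_
    have hexp := h (Real.exp (A / V)) (Real.exp_pos _)
    rw [Real.log_exp, ← hB0, mul_zero, mul_add, mul_div_cancel₀ _ hV.ne'] at hexp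
    linarith
  refine ⟨hB_pos, ?_⟩
  have hopt := h (V / B) (div_pos hV hB_pos)
  rw [div_mul_cancel₀ _ hB_pos.ne'] at hopt
  linarith

theorem ofReal_mul_log_div_le_of_forall {V : ℝ} {A B : ℝ≥0∞}
    (h : A ≠ ⊤ → B ≠ ⊤ → ∀ t, 0 < t → V * (1 + Real.log t) ≤ A.toReal + t * B.toReal) :
    ((ENNReal.ofReal V : ℝ≥0∞) : EReal) * ENNReal.log (ENNReal.ofReal V / B) ≤ (A : EReal) := by
  rcases le_or_gt V 0 with hV | hV
  · simpa [ENNReal.ofReal_of_nonpos hV] using EReal.coe_ennreal_nonneg A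
  have hV_coe : ((ENNReal.ofReal V : ℝ≥0∞) : EReal) = (V : EReal) := by
    rw [EReal.coe_ennreal_ofReal, max_eq_left hV.le]
  by_cases hA : A = ⊤
  · simp [hA]
  by_cases hB : B = ⊤
  · simp [hB, hV_coe, EReal.coe_mul_bot_of_pos hV]
  obtain ⟨hB_pos, hle⟩ :=
    pos_and_mul_log_div_le_of_forall hV ENNReal.toReal_nonneg (h hA hB)
  rw [hV_coe, ← EReal.coe_ennreal_toReal hA, ← ENNReal.ofReal_toReal hB,
    ← ENNReal.ofReal_div_of_pos hB_pos, ENNReal.log_ofReal_of_pos (div_pos hV hB_pos)]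
  exact_mod_cast hle

/-! ### The inequality on the product space -/

section Conclusion

theorem IsFluctuation.toReal_eLpNorm_one {X : Type*} [MeasurableSpace X] {μ : Measure X}
    [IsProbabilityMeasure μ] {κ : Kernel X X} [IsMarkovKernel κ] (hκ : κ.Invariant μ)
    {g G : X → ℝ} (h : IsFluctuation κ μ g G) :
    (eLpNorm G 1 μ).toReal = ∫ z, |g z - avg κ g z| ∂μ := by
  rw [eLpNorm_one_eq_lintegral_enorm, ← integral_norm_eq_lintegral_enorm (h.memLp_grad hκ).1]
  exact integral_congr_ae (h.ae_eq.mono fun z hz => by simp only [hz, Real.norm_eq_abs])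

variable {S : Type*} {p : I}

theorem toReal_energy {f : Space S → ℝ} (hf : AEStronglyMeasurable f (mu S p)) :
    (energy p f).toReal = ∫ z, f z ^ 2 ∂(mu S p) :=
  (integral_eq_lintegral_of_nonneg_ae (ae_of_all _ fun _ => sq_nonneg _) (hf.pow 2)).symm

theorem energy_congr_ae {f g : Space S → ℝ} (h : f =ᵐ[mu S p] g) : energy p f = energy p g :=
  lintegral_congr_ae (h.mono fun z hz => by simp only [hz])

theorem coordConst_pos (hp0 : 0 < p) (hp1 : p < 1) : ∀ j : S ⊕ ℕ, 0 < coordConst p j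
  | .inl _ => cLS_pos hp0 hp1
  | .inr _ => two_pos

theorem evariance_mul_log_le_tsum [Countable S] (hp0 : 0 < p) (hp1 : p < 1) {f : Space S → ℝ}
    {D G : S ⊕ ℕ → Space S → ℝ} (hD : ∀ j, IsFluctuation (coordKernel p j) (mu S p) f (D j))
    (hG : ∀ j, CoordGrad p j f (G j)) :
    (evariance f (mu S p) : EReal) *
        ENNReal.log (evariance f (mu S p) / ∑' j, eLpNorm (D j) 1 (mu S p) ^ 2)
      ≤ ((∑' j, ENNReal.ofReal (coordConst p j) * energy p (G j) : ℝ≥0∞) : EReal) := by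
  obtain ⟨_⟩ := nonempty_denumerable (S ⊕ ℕ)
  let e : ℕ ≃ S ⊕ ℕ := (Denumerable.eqv (S ⊕ ℕ)).symm
  have hD_toReal (j : S ⊕ ℕ) : (eLpNorm (D j) 1 (mu S p) ^ 2).toReal
      = (∫ z, |f z - avg (coordKernel p j) f z| ∂(mu S p)) ^ 2 := by
    rw [ENNReal.toReal_pow, (hD j).toReal_eLpNorm_one (isResampling_coordKernel j).invariant]
  have hG_toReal (j : S ⊕ ℕ) : (ENNReal.ofReal (coordConst p j) * energy p (G j)).toReal
      = coordConst p j * ∫ z, G j z ^ 2 ∂(mu S p) := by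
    rw [ENNReal.toReal_mul, ENNReal.toReal_ofReal (coordConst_pos hp0 hp1 j).le,
      toReal_energy (hG j).memLp_grad.1]
  rw [← ofReal_variance (hG (.inr 0)).memLp]
  refine ofReal_mul_log_div_le_of_forall fun hG_ne_top hD_ne_top t ht => ?_
  have hG_summable := ENNReal.summable_toReal hG_ne_top
  have hD_summable := ENNReal.summable_toReal hD_ne_top
  rw [ENNReal.tsum_toReal_eq (ENNReal.ne_top_of_tsum_ne_top hG_ne_top),
    ENNReal.tsum_toReal_eq (ENNReal.ne_top_of_tsum_ne_top hD_ne_top)]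
  simp only [hG_toReal, hD_toReal] at hG_summable hD_summable ⊢
  rw [← e.tsum_eq, ← e.tsum_eq fun j => (∫ z, |f z - avg (coordKernel p j) f z| ∂(mu S p)) ^ 2]
  exact (isLogSobolev_coordGrad hp0 hp1 e.injective).variance_mul_le (fun n => hG (e n))
    (isResamplingFamily_coordKernel e.surjective) (e.summable_iff.2 hG_summable)
    (e.summable_iff.2 hD_summable) ht

theorem isFluctuation_deltaBer {f g : Space S → ℝ} (hg : StronglyMeasurable g)
    (hg_memLp : MemLp g 2 (mu S p)) (h : f =ᵐ[mu S p] g) (s : S) :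
    IsFluctuation (coordKernel p (.inl s)) (mu S p) g (deltaBer p s f) where
  stronglyMeasurable := hg
  memLp := hg_memLp
  ae_eq := by
    filter_upwards [h, ae_ae_of_measurePreserving_uncurry (measurePreserving_updateBer s) h]
      with z hz hline
    rw [avg_coordKernel_inl hg, ← hz, ← integral_congr_ae hline]
    rfl

theorem isFluctuation_deltaGauss {f g : Space S → ℝ} (hg : StronglyMeasurable g)
    (hg_memLp : MemLp g 2 (mu S p)) (h : f =ᵐ[mu S p] g) (i : ℕ) :
    IsFluctuation (coordKernel p (.inr i)) (mu S p) g (deltaGauss i f) where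
  stronglyMeasurable := hg
  memLp := hg_memLp
  ae_eq := by
    filter_upwards [h, ae_ae_of_measurePreserving_uncurry (measurePreserving_updateGauss i) h]
      with z hz hline
    rw [avg_coordKernel_inr hg, ← hz, ← integral_congr_ae hline]
    rfl

theorem IsPartialDeriv.congr {f f' h h' : Space S → ℝ} {i : ℕ} (hfh : IsPartialDeriv p i f h)
    (hf : f =ᵐ[mu S p] f') (hh : h =ᵐ[mu S p] h') : IsPartialDeriv p i f' h' := by
  refine ⟨hfh.1.ae_eq hh, ?_⟩
  have hline {u u' : Space S → ℝ} (hu : u =ᵐ[mu S p] u') :=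
    ae_ae_of_measurePreserving_uncurry (measurePreserving_updateGauss i) hu
  filter_upwards [hfh.2, hline hf, hline hh] with z hderiv hfz hhz
  exact hderiv.congr (volume_absolutelyContinuous_gauss.ae_le hfz)
    (volume_absolutelyContinuous_gauss.ae_le hhz)

end Conclusion

end BernoulliGauss

end

/-- The inequality holds in `[-∞, ∞]`: the sums may be infinite, `log 0 = -∞`, and the left side is
`0` if the variance is `0`. -/
theorem mainTheorem6 {S : Type*} [Countable S] (p : unitInterval) (hp0 : 0 < p) (hp1 : p < 1)
    (f : BernoulliGauss.Space S → ℝ) (hf : BernoulliGauss.MemH12 p f)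
    (df : ℕ → BernoulliGauss.Space S → ℝ)
    (hdf : ∀ i, BernoulliGauss.IsPartialDeriv p i f (df i)) :
    ((evariance f (BernoulliGauss.mu S p) : ℝ≥0∞) : EReal) *
        ENNReal.log (evariance f (BernoulliGauss.mu S p) /
          ((∑' s : S, eLpNorm (BernoulliGauss.deltaBer p s f) 1 (BernoulliGauss.mu S p) ^ 2) +
            ∑' i : ℕ, eLpNorm (BernoulliGauss.deltaGauss i f) 1 (BernoulliGauss.mu S p) ^ 2))
      ≤ ((ENNReal.ofReal (BernoulliGauss.cLS p) *
            (∑' s : S, BernoulliGauss.energy p (BernoulliGauss.deltaBer p s f)) +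
          2 * ∑' i : ℕ, BernoulliGauss.energy p (df i) : ℝ≥0∞) : EReal) := by
  have hf_mk := hf.1.1.ae_eq_mk
  have hdf_mk := fun i => (hdf i).1.1.ae_eq_mk
  set g := hf.1.1.mk f
  have hg : StronglyMeasurable g := hf.1.1.stronglyMeasurable_mk
  have hg_memLp : MemLp g 2 (BernoulliGauss.mu S p) := hf.1.ae_eq hf_mk
  have hBer := BernoulliGauss.isFluctuation_deltaBer hg hg_memLp hf_mk
  have hGauss := BernoulliGauss.isFluctuation_deltaGauss hg hg_memLp hf_mk
  have hGrad : ∀ i, BernoulliGauss.IsGaussGrad p i g ((hdf i).1.1.mk (df i)) := fun i =>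
    ⟨hg, hg_memLp, (hdf i).1.1.stronglyMeasurable_mk, (hdf i).congr hf_mk (hdf_mk i)⟩
  have hmain := BernoulliGauss.evariance_mul_log_le_tsum hp0 hp1
    (D := Sum.elim (BernoulliGauss.deltaBer p · f) (BernoulliGauss.deltaGauss · f))
    (G := Sum.elim (BernoulliGauss.deltaBer p · f) fun i => (hdf i).1.1.mk (df i))
    (Sum.rec hBer hGauss) (Sum.rec hBer hGrad)
  rw [Summable.tsum_sum ENNReal.summable ENNReal.summable,
    Summable.tsum_sum ENNReal.summable ENNReal.summable] at hmain
  simpa only [evariance_congr hf_mk, BernoulliGauss.energy_congr_ae (hdf_mk _), Sum.elim_inl,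
    Sum.elim_inr, BernoulliGauss.coordConst, ENNReal.ofReal_ofNat, ENNReal.tsum_mul_left] using
    hmain
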